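/- \textbf{Setting.} Let $x_{t+1}=f(x_t)+Bu_t+w_t$, $t\ge 0$, where $x_t,w_t\in\mathbb{R}^N$, $u_t\in\mathbb{R}^m$, $B:\mathbb{R}^m\to\mathbb{R}^N$ is linear, $(w_t)_{t\ge0}$ is an i.i.d. noise sequence independent of $x_0$, and $f:\mathbb{R}^N\to\mathbb{R}^N$ is continuously differentiable and invertible. Let $|J(f(x))|$ be the absolute value of the Jacobian determinant of $f$ at $x$, and suppose that $$M:=\sup_{x}\log_2|J(f(x))|<\infty,\qquad L:=\inf_{x}\log_2|J(f(x))|>-\infty$$ (in particular the determinant never vanishes). Suppose that the law of $x_0$ is absolutely continuous with respect to Lebesgue measure, with differential entropy $h(x_0)<\infty$. The system is controlled over a channel with finite input alphabet $\mathcal{M}$ and finite output alphabet $\mathcal{M}'$, given by conditional laws $P(q'_t\mid q_{[0,t]},q'_{[0,t-1]})$, $t\ge0$, with noiseless feedback. An admissible policy consists of measurable encoders $q_t=\gamma^e_t(x_{[0,t]},q'_{[0,t-1]})\in\mathcal{M}$ and controllers $u_t=\gamma_t(q'_{[0,t]})$, $t\ge 0$. The channel is of Class A with feedback capacity $C$: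 for every $t\ge0$, almost surely for every set $S\subseteq\mathcal{M}'$, $$P(q'_t\in S\mid q_{[0,t]},q'_{[0,t-1]},x_0,(w_s)_{s\ge0})=P(q'_t\in S\mid q_{[0,t]},q'_{[0,t-1]}),$$ and the following limit exists and equals $C$: $$C=\lim_{T\to\infty}\ \max_{\{P(q_t\mid q_{[0,t-1]},q'_{[0,t-1]}),\ 0\le t\le T-1\}}\ \frac1T\sum_{t=0}^{T-1}I\big(q_{[0,t]};q'_t\mid q'_{[0,t-1]}\big),$$ where the maximum is over all families of channel input kernels, mutual information is in bits, and the term for $t=0$ is $I(q_0;q'_0)$. \textbf{Theorem.} If $C<L$, then under any admissible policy $$\limsup_{T\to\infty}P\big(|x_T|\le b(T)\big)\le 1-\frac{L-C}{M}$$ for every $b:\mathbb{N}\to(0,\infty)$ such that $\lim_{T\to\infty}\frac1T\log_2 b(T)=0$, where $|\cdot|$ is the Euclidean norm. -/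

import Mathlib

open MeasureTheory ProbabilityTheory Filter Topology

noncomputable section

namespace NetCtrl

/-! ## Discrete information measures, in bits -/

/-- Probability of the event `X = a` when the sample point has law `p`. -/
def prob {Ω α : Type*} (p : PMF Ω) (X : Ω → α) (a : α) : ℝ :=
  (p.map X a).toReal

/-- Conditional entropy
`H(Y | Z) = ∑ z, P(Z = z) · (-∑ y, P(Y = y | Z = z) log₂ P(Y = y | Z = z))`. -/
def condEntropy {Ω α β : Type*} [Fintype α] [Fintype β]
    (p : PMF Ω) (Y : Ω → α) (Z : Ω → β) : ℝ :=
  ∑ z, prob p Z z *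
    (-∑ y, ((prob p (fun ω => (Y ω, Z ω)) (y, z) / prob p Z z) *
      Real.logb 2 (prob p (fun ω => (Y ω, Z ω)) (y, z) / prob p Z z)))

/-- Conditional mutual information `I(X ; Y | Z) = H(Y | Z) - H(Y | X, Z)`. -/
def condMutualInfo {Ω α β γ : Type*} [Fintype α] [Fintype β] [Fintype γ]
    (p : PMF Ω) (X : Ω → α) (Y : Ω → β) (Z : Ω → γ) : ℝ :=
  condEntropy p Y Z - condEntropy p Y (fun ω => (X ω, Z ω))

/-! ## Channels with feedback -/

/-- A finite-alphabet channel with memory: `W t q_{[0,t]} q'_{[0,t-1]}` is the conditional law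
of the channel output `q'_t`. -/
abbrev Channel (A A' : Type*) : Type _ :=
  (t : ℕ) → (Fin (t + 1) → A) → (Fin t → A') → PMF A'

/-- A family of channel input kernels `P(q_t | q_{[0,t-1]}, q'_{[0,t-1]})`, `t ≥ 0`. -/
abbrev InputKernels (A A' : Type*) : Type _ :=
  (t : ℕ) → (Fin t → A) → (Fin t → A') → PMF A

/-- The joint law of `(q_{[0,T-1]}, q'_{[0,T-1]})` induced by input kernels `π` and a
channel `W`. -/
def jointLaw {A A' : Type*} (W : Channel A A') (π : InputKernels A A') :
    (T : ℕ) → PMF ((Fin T → A) × (Fin T → A'))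
  | 0 => PMF.pure (Fin.elim0, Fin.elim0)
  | T + 1 =>
      (jointLaw W π T).bind fun h =>
        (π T h.1 h.2).bind fun a =>
          (W T (Fin.snoc (α := fun _ => A) h.1 a) h.2).map fun b =>
            (Fin.snoc (α := fun _ => A) h.1 a, Fin.snoc (α := fun _ => A') h.2 b)

/-- The directed information
`I(q_{[0,T-1]} → q'_{[0,T-1]}) = ∑_{t=0}^{T-1} I(q_{[0,t]} ; q'_t | q'_{[0,t-1]})`
of a law on pairs of input and output strings of length `T`. For `t = 0` the conditioning
variable is constant, so that the term is `I(q_0 ; q'_0)`. -/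
def directedInfo {A A' : Type*} [Fintype A] [Fintype A'] {T : ℕ}
    (p : PMF ((Fin T → A) × (Fin T → A'))) : ℝ :=
  ∑ t : Fin T, condMutualInfo p
    (fun h (i : Fin (t + 1)) => h.1 (Fin.castLE t.isLt i))
    (fun h => h.2 t)
    (fun h (i : Fin t) => h.2 (Fin.castLE t.isLt.le i))

/-- `max (1/T) I(q_{[0,T-1]} → q'_{[0,T-1]})` over all input kernels with feedback.
(Directed information is at most `T log₂ |A'|`, so this is a supremum of a bounded set.) -/
def maxDirectedInfoRate {A A' : Type*} [Fintype A] [Fintype A'] (W : Channel A A') (T : ℕ) : ℝ :=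
  ⨆ π : InputKernels A A', (1 / (T : ℝ)) * directedInfo (jointLaw W π T)

/-! ## The control loop -/

/-- The state space `ℝ^N` with the Euclidean norm. -/
abbrev Vec (N : ℕ) : Type := EuclideanSpace ℝ (Fin N)

/-- The initial segment `X_{[0,n-1]}` of a sequence of random variables. -/
def hist {Ω α : Type*} (X : ℕ → Ω → α) (n : ℕ) (ω : Ω) : Fin n → α := fun i => X i ω

/-- The σ-algebra generated by `q_{[0,t]}` and `q'_{[0,t-1]}`. -/
abbrev channelPast {Ω A A' : Type*} [MeasurableSpace A] [MeasurableSpace A']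
    (q : ℕ → Ω → A) (q' : ℕ → Ω → A') (t : ℕ) : MeasurableSpace Ω :=
  MeasurableSpace.comap (hist q (t + 1)) inferInstance ⊔
    MeasurableSpace.comap (hist q' t) inferInstance

/-- The σ-algebra generated by `x_0` and the whole noise sequence `w_s`, `s ≥ 0`. -/
abbrev sourceSigma {Ω : Type*} {N : ℕ} (x₀ : Ω → Vec N) (w : ℕ → Ω → Vec N) : MeasurableSpace Ω :=
  MeasurableSpace.comap x₀ inferInstance ⊔
    MeasurableSpace.comap (fun ω s => w s ω) inferInstance

/-- `log₂ |J(f(x))|`, the logarithm of the absolute value of the Jacobian determinant. It is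
only used together with the requirement that the determinant does not vanish. -/
def logJac {N : ℕ} (f : Vec N → Vec N) (x : Vec N) : ℝ :=
  Real.logb 2 |(fderiv ℝ f x).det|

/-- `L = inf_x log₂|J(f(x))| > -∞` and `M = sup_x log₂|J(f(x))| < ∞`. Since `log₂ 0 = -∞`,
the first part contains that the Jacobian determinant vanishes nowhere. -/
structure LogJacBounds {N : ℕ} (f : Vec N → Vec N) (L M : ℝ) : Prop where
  det_ne_zero : ∀ x, (fderiv ℝ f x).det ≠ 0
  isGLB : IsGLB (Set.range (logJac f)) L
  isLUB : IsLUB (Set.range (logJac f)) M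

/-- Differential entropy `h = -∫ p log₂ p dx` in bits, with values in `[-∞, ∞]`, of an absolutely
continuous law with density `p = dρ/dx`. The integral is the difference of the integrals of the
positive and negative parts of `p log₂ p`; in `EReal`, `⊤ - ⊤ = ⊥`, so this is `< ⊤` exactly when
the negative part of `p log₂ p` is integrable. -/
def diffEntropy {N : ℕ} (ρ : Measure (Vec N)) : EReal :=
  -(((∫⁻ x, ENNReal.ofReal ((ρ.rnDeriv volume x).toReal *
        Real.logb 2 (ρ.rnDeriv volume x).toReal) : ENNReal) : EReal) -
    ((∫⁻ x, ENNReal.ofReal (-((ρ.rnDeriv volume x).toReal *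
        Real.logb 2 (ρ.rnDeriv volume x).toReal)) : ENNReal) : EReal))

/-- The closed loop formed by the system `x_{t+1} = f(x_t) + B u_t + w_t`, the channel `W`, the
encoders `γe t` and the controllers `γc t`. -/
structure IsClosedLoop {Ω A A' : Type*} [MeasurableSpace Ω]
    [MeasurableSpace A] [MeasurableSpace A'] {N m : ℕ}
    (P : Measure Ω) (f : Vec N → Vec N) (B : Vec m →ₗ[ℝ] Vec N) (ν : Measure (Vec N))
    (W : Channel A A')
    (γe : (t : ℕ) → (Fin (t + 1) → Vec N) → (Fin t → A') → A)
    (γc : (t : ℕ) → (Fin (t + 1) → A') → Vec m)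
    (x w : ℕ → Ω → Vec N) (u : ℕ → Ω → Vec m) (q : ℕ → Ω → A) (q' : ℕ → Ω → A') : Prop where
  measurable_init : Measurable (x 0)
  measurable_noise : ∀ t, Measurable (w t)
  measurable_output : ∀ t, Measurable (q' t)
  measurable_encoder : ∀ t, Measurable (Function.uncurry (γe t))
  /-- The noise is i.i.d. with law `ν` and independent of the initial state. -/
  noise_indep : iIndepFun w P
  noise_law : ∀ t, P.map (w t) = ν
  init_indep : IndepFun (x 0) (fun ω s => w s ω) P
  /-- `x_{t+1} = f(x_t) + B u_t + w_t`. -/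
  state_eq : ∀ t ω, x (t + 1) ω = f (x t ω) + B (u t ω) + w t ω
  /-- `q_t = γe_t(x_{[0,t]}, q'_{[0,t-1]})`. -/
  encoder_eq : ∀ t ω, q t ω = γe t (hist x (t + 1) ω) (hist q' t ω)
  /-- `u_t = γc_t(q'_{[0,t]})`. -/
  control_eq : ∀ t ω, u t ω = γc t (hist q' (t + 1) ω)
  /-- `P(q'_t = b | q_{[0,t]}, q'_{[0,t-1]})` is given by the channel. -/
  channel_law : ∀ t (b : A'), P⟦q' t ⁻¹' {b} | channelPast q q' t⟧ =ᵐ[P]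
    fun ω => (W t (hist q (t + 1) ω) (hist q' t ω) b).toReal

/-- The channel `W`, used in a loop with initial state `x₀`, noise `w`, inputs `q` and outputs
`q'`, is of Class A with feedback capacity `C`. -/
structure IsClassA {Ω A A' : Type*} [MeasurableSpace Ω] [Fintype A] [Fintype A']
    [MeasurableSpace A] [MeasurableSpace A'] {N : ℕ}
    (P : Measure Ω) (W : Channel A A') (x₀ : Ω → Vec N) (w : ℕ → Ω → Vec N)
    (q : ℕ → Ω → A) (q' : ℕ → Ω → A') (C : ℝ) : Prop where
  /-- `q'_t ↔ q_{[0,t]}, q'_{[0,t-1]} ↔ {x_0, w_s, s ≥ 0}` is a Markov chain. -/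
  markov : ∀ t (S : Set A'),
    P⟦q' t ⁻¹' S | channelPast q q' t ⊔ sourceSigma x₀ w⟧ =ᵐ[P] P⟦q' t ⁻¹' S | channelPast q q' t⟧
  /-- `C = lim_T max (1/T) I(q_{[0,T-1]} → q'_{[0,T-1]})`; the limit exists. -/
  capacity : Tendsto (maxDirectedInfoRate W) atTop (𝓝 C)

end NetCtrl

end

/-!
Fix a channel output string `s`. The controls it triggers are then constants, so the resulting
state at time `T` is a function of the source `(x₀, w)` alone. Since `f` expands volumes by at
least `2 ^ L` per step and `x₀` has, up to a small probability, a bounded density, that state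
lies in a given ball with probability about `2 ^ (-T L)`.

In the closed loop `s` is the realized output string, which depends on the source. Reweighting `P`
by `P(q'_{[0,T-1]}) / ∏ P(q'_t | q_{[0,t]}, q'_{[0,t-1]})` makes the outputs independent of the
source, and the expected logarithm of this weight is minus the directed information, hence at
least `-T` times the maximal rate. By Jensen's inequality for the logarithm, an event that has
probability at most `ε` for every fixed output string has probability `p` in the closed loop with
`p log₂ (1 / ε) ≤ T R_T + 1`, where `R_T` tends to `C`. With `ε ≈ 2 ^ (-T L)` and ball radii of
subexponential size this gives `p ≤ C / L` in the limit.
-/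

namespace NetCtrl

section FiniteValued

variable {Ω α : Type*} [MeasurableSpace Ω]

/-- The probability `P(V = v)` of the value `v = V ω` that the random variable `V` takes at the
sample point `ω`. Entropies are expectations of logarithms of such probabilities. -/
def realizedProb (P : Measure Ω) (V : Ω → α) (ω : Ω) : ENNReal :=
  P (V ⁻¹' {V ω})

theorem realizedProb_ne_top (P : Measure Ω) [IsFiniteMeasure P] (V : Ω → α) (ω : Ω) :
    realizedProb P V ω ≠ ⊤ :=
  measure_ne_top _ _

theorem ae_realizedProb_ne_zero [Countable α] (P : Measure Ω) (V : Ω → α) :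
    ∀ᵐ ω ∂P, realizedProb P V ω ≠ 0 := by
  have hnull : P (⋃ v ∈ {v | P (V ⁻¹' {v}) = 0}, V ⁻¹' {v}) = 0 :=
    (measure_biUnion_null_iff (Set.to_countable _)).2 fun v hv => hv
  refine measure_mono_null (fun ω hω => ?_) hnull
  exact Set.mem_biUnion (x := V ω) (not_not.1 hω) rfl

theorem realizedProb_eq_of_eq_iff {β : Type*} (P : Measure Ω) {V : Ω → α} {V' : Ω → β}
    (h : ∀ ω ω', V ω' = V ω ↔ V' ω' = V' ω) : realizedProb P V = realizedProb P V' :=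
  funext fun ω => congrArg P (Set.ext (h ω))

section Finite

variable [Finite α] [MeasurableSpace α] [MeasurableSingletonClass α]

theorem integrable_comp_of_finite (P : Measure Ω) [IsFiniteMeasure P] {V : Ω → α}
    (hV : Measurable V) (F : α → ℝ) : Integrable (fun ω => F (V ω)) P :=
  (Integrable.of_finite (μ := P.map V) (f := F)).comp_measurable hV

theorem integrable_logb_realizedProb (P : Measure Ω) [IsFiniteMeasure P] {V : Ω → α}
    (hV : Measurable V) : Integrable (fun ω => Real.logb 2 (realizedProb P V ω).toReal) P :=
  integrable_comp_of_finite P hV fun v => Real.logb 2 (P.real (V ⁻¹' {v}))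

end Finite

theorem integral_comp_eq_sum [Fintype α] [MeasurableSpace α] [MeasurableSingletonClass α]
    (P : Measure Ω) [IsFiniteMeasure P] {V : Ω → α} (hV : Measurable V) (F : α → ℝ) :
    ∫ ω, F (V ω) ∂P = ∑ v, P.real (V ⁻¹' {v}) * F v := by
  rw [← integral_map hV.aemeasurable (Measurable.of_discrete (f := F)).aestronglyMeasurable,
    integral_fintype Integrable.of_finite]
  exact Finset.sum_congr rfl fun v _ => by
    rw [smul_eq_mul, map_measureReal_apply hV (measurableSet_singleton v)]

end FiniteValued

section DiscreteEntropy

variable {Ω α β γ : Type*}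

theorem prob_nonneg (p : PMF Ω) (X : Ω → α) (a : α) : 0 ≤ prob p X a :=
  ENNReal.toReal_nonneg

theorem prob_le_one (p : PMF Ω) (X : Ω → α) (a : α) : prob p X a ≤ 1 :=
  ENNReal.toReal_mono ENNReal.one_ne_top (PMF.coe_le_one _ _)

theorem prob_prodMk_le (p : PMF Ω) (Y : Ω → α) (Z : Ω → β) (y : α) (z : β) :
    prob p (fun ω => (Y ω, Z ω)) (y, z) ≤ prob p Z z := by
  have hmap : (p.map fun ω => (Y ω, Z ω)).map Prod.snd = p.map Z := PMF.map_comp _ _ _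
  refine ENNReal.toReal_mono (PMF.apply_ne_top _ _) ?_
  rw [← hmap, PMF.map_apply Prod.snd]
  exact (if_pos rfl).ge.trans (ENNReal.le_tsum (y, z))

section Bounds

variable [Fintype α] [Fintype β]

theorem condEntropy_nonneg (p : PMF Ω) (Y : Ω → α) (Z : Ω → β) : 0 ≤ condEntropy p Y Z := by
  refine Finset.sum_nonneg fun z _ => mul_nonneg (prob_nonneg _ _ _) (neg_nonneg.2 ?_)
  refine Finset.sum_nonpos fun y _ => ?_
  have hratio := div_nonneg (prob_nonneg p (fun ω => (Y ω, Z ω)) (y, z)) (prob_nonneg p Z z)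
  exact mul_nonpos_of_nonneg_of_nonpos hratio (Real.logb_nonpos one_lt_two hratio
    (div_le_one_of_le₀ (prob_prodMk_le _ _ _ _ _) (prob_nonneg _ _ _)))

theorem neg_mul_logb_two_le {x : ℝ} (hx : 0 ≤ x) : -(x * Real.logb 2 x) ≤ 1 / Real.log 2 := by
  have hnegMulLog : -(x * Real.log x) ≤ 1 := by
    have := Real.negMulLog_le_one_sub_self hx
    rw [Real.negMulLog] at this
    linarith
  rw [Real.logb, ← mul_div_assoc, ← neg_div]
  exact div_le_div_of_nonneg_right hnegMulLog (Real.log_nonneg one_le_two)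

theorem condEntropy_le (p : PMF Ω) (Y : Ω → α) (Z : Ω → β) :
    condEntropy p Y Z ≤ Fintype.card β * (Fintype.card α * (1 / Real.log 2)) := by
  rw [condEntropy, ← nsmul_eq_mul, ← Finset.card_univ]
  refine Finset.sum_le_card_nsmul _ _ _ fun z _ => ?_
  refine (mul_le_mul_of_nonneg_left ?_ (prob_nonneg _ _ _)).trans
    (mul_le_of_le_one_left (by positivity [Real.log_pos one_lt_two]) (prob_le_one _ _ _))
  rw [← Finset.sum_neg_distrib, ← nsmul_eq_mul, ← Finset.card_univ]
  exact Finset.sum_le_card_nsmul _ _ _ fun y _ =>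
    neg_mul_logb_two_le (div_nonneg (prob_nonneg _ _ _) (prob_nonneg _ _ _))

theorem condMutualInfo_le [Fintype γ] (p : PMF Ω) (X : Ω → γ) (Y : Ω → α) (Z : Ω → β) :
    condMutualInfo p X Y Z ≤ Fintype.card β * (Fintype.card α * (1 / Real.log 2)) :=
  (sub_le_self _ (condEntropy_nonneg _ _ _)).trans (condEntropy_le _ _ _)

end Bounds

section Law

variable {Ω' : Type*} [MeasurableSpace Ω] {P : Measure Ω}
  [Countable Ω'] [MeasurableSpace Ω'] [MeasurableSingletonClass Ω'] {p : PMF Ω'} {H : Ω → Ω'}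

theorem prob_eq_measureReal (hH : Measurable H) (hp : p.toMeasure = P.map H) (X : Ω' → α)
    (a : α) : prob p X a = P.real ((fun ω => X (H ω)) ⁻¹' {a}) := by
  rw [prob, ← PMF.toOuterMeasure_apply_singleton, PMF.toOuterMeasure_map_apply,
    ← PMF.toMeasure_apply_eq_toOuterMeasure, hp, Measure.map_apply hH MeasurableSet.of_discrete]
  rfl

variable [IsFiniteMeasure P]

theorem integrable_logb_realizedProb_comp [Finite α] [MeasurableSpace α]
    [MeasurableSingletonClass α] (hH : Measurable H) (V : Ω' → α) :
    Integrable (fun ω => Real.logb 2 (realizedProb P (fun ω => V (H ω)) ω).toReal) P :=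
  integrable_logb_realizedProb P ((Measurable.of_discrete (f := V)).comp hH)

variable [Fintype α] [MeasurableSpace α] [MeasurableSingletonClass α]
  [Fintype β] [MeasurableSpace β] [MeasurableSingletonClass β]

theorem condEntropy_eq_integral (hH : Measurable H) (hp : p.toMeasure = P.map H) (Y : Ω' → α)
    (Z : Ω' → β) :
    condEntropy p Y Z = ∫ ω, (Real.logb 2 (realizedProb P (fun ω => Z (H ω)) ω).toReal -
      Real.logb 2 (realizedProb P (fun ω => (Y (H ω), Z (H ω))) ω).toReal) ∂P := by
  have hYZ : Measurable fun ω => (Y (H ω), Z (H ω)) :=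
    (Measurable.of_discrete (f := fun h => (Y h, Z h))).comp hH
  refine Eq.trans ?_ (integral_comp_eq_sum P hYZ fun v =>
    Real.logb 2 (P.real ((fun ω => Z (H ω)) ⁻¹' {v.2})) -
      Real.logb 2 (P.real ((fun ω => (Y (H ω), Z (H ω))) ⁻¹' {v}))).symm
  rw [condEntropy, Fintype.sum_prod_type_right]
  refine Finset.sum_congr rfl fun z _ => ?_
  rw [← Finset.sum_neg_distrib, Finset.mul_sum]
  refine Finset.sum_congr rfl fun y _ => ?_
  rw [← prob_eq_measureReal hH hp Z, ← prob_eq_measureReal hH hp fun h => (Y h, Z h)]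
  obtain hyz | hyz := (prob_nonneg p (fun h => (Y h, Z h)) (y, z)).eq_or_lt
  · simp only [← hyz, zero_div, zero_mul, neg_zero, mul_zero]
  · have hz : prob p Z z ≠ 0 := (hyz.trans_le (prob_prodMk_le p Y Z y z)).ne'
    rw [Real.logb_div hyz.ne' hz]
    field_simp
    ring

theorem condMutualInfo_eq_integral [Fintype γ] [MeasurableSpace γ] [MeasurableSingletonClass γ]
    (hH : Measurable H) (hp : p.toMeasure = P.map H) (X : Ω' → γ) (Y : Ω' → α) (Z : Ω' → β) :
    condMutualInfo p X Y Z =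
      ∫ ω, ((Real.logb 2 (realizedProb P (fun ω => (Y (H ω), X (H ω), Z (H ω))) ω).toReal -
          Real.logb 2 (realizedProb P (fun ω => (X (H ω), Z (H ω))) ω).toReal) -
        (Real.logb 2 (realizedProb P (fun ω => (Y (H ω), Z (H ω))) ω).toReal -
          Real.logb 2 (realizedProb P (fun ω => Z (H ω)) ω).toReal)) ∂P := by
  have hZ := integrable_logb_realizedProb_comp (P := P) hH Z
  have hYZ := integrable_logb_realizedProb_comp (P := P) hH fun h => (Y h, Z h)
  have hXZ := integrable_logb_realizedProb_comp (P := P) hH fun h => (X h, Z h)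
  have hYXZ := integrable_logb_realizedProb_comp (P := P) hH fun h => (Y h, X h, Z h)
  rw [condMutualInfo, condEntropy_eq_integral hH hp, condEntropy_eq_integral hH hp]
  refine (integral_sub (hZ.sub hYZ) (hXZ.sub hYXZ)).symm.trans (integral_congr_ae ?_)
  filter_upwards with ω
  simp only [Pi.sub_apply]
  ring

end Law

end DiscreteEntropy

section DirectedInfoRate

variable {A A' : Type*} [Fintype A] [Fintype A']

theorem bddAbove_range_directedInfo (W : Channel A A') (T : ℕ) :
    BddAbove (Set.range fun π : InputKernels A A' =>
      (1 / (T : ℝ)) * directedInfo (jointLaw W π T)) := by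
  refine ⟨1 / (T : ℝ) * ∑ t : Fin T,
    (Fintype.card (Fin t → A') * (Fintype.card A' * (1 / Real.log 2)) : ℝ), ?_⟩
  rintro _ ⟨π, rfl⟩
  exact mul_le_mul_of_nonneg_left (Finset.sum_le_sum fun t _ => condMutualInfo_le _ _ _ _)
    (by positivity)

theorem directedInfo_jointLaw_le (W : Channel A A') (π : InputKernels A A') (T : ℕ) :
    directedInfo (jointLaw W π T) ≤ T * maxDirectedInfoRate W T := by
  obtain rfl | hT := Nat.eq_zero_or_pos T
  · simp [directedInfo]
  · have hT : (0 : ℝ) < T := Nat.cast_pos.2 hT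
    have hle : 1 / (T : ℝ) * directedInfo (jointLaw W π T) ≤ maxDirectedInfoRate W T :=
      le_ciSup (bddAbove_range_directedInfo W T) π
    rwa [one_div, inv_mul_le_iff₀ hT] at hle

end DirectedInfoRate

section ConditionalProbability

variable {Ω : Type*} {m mΩ : MeasurableSpace Ω} {P : Measure Ω}

theorem lintegral_condLExp_mul (hm : m ≤ mΩ) [SigmaFinite (P.trim hm)] {X g : Ω → ENNReal}
    (hX : AEMeasurable X P) (hg : Measurable[m] g) :
    ∫⁻ ω, P⁻[X | m] ω * g ω ∂P = ∫⁻ ω, X ω * g ω ∂P := by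
  have htrim : (P.withDensity P⁻[X | m]).trim hm = (P.withDensity X).trim hm := by
    refine @Measure.ext _ m _ _ fun F hF => ?_
    rw [trim_measurableSet_eq hm hF, trim_measurableSet_eq hm hF, withDensity_apply _ (hm _ hF),
      withDensity_apply _ (hm _ hF), setLIntegral_condLExp hm P X hF]
  have hg' : AEMeasurable g P := (hg.mono hm le_rfl).aemeasurable
  calc ∫⁻ ω, P⁻[X | m] ω * g ω ∂P = ∫⁻ ω, g ω ∂(P.withDensity P⁻[X | m]) :=
        (lintegral_withDensity_eq_lintegral_mul₀ (measurable_condLExp' m P X).aemeasurable hg').symm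
    _ = ∫⁻ ω, g ω ∂(P.withDensity X) := by rw [← lintegral_trim hm hg, htrim, lintegral_trim hm hg]
    _ = ∫⁻ ω, X ω * g ω ∂P := lintegral_withDensity_eq_lintegral_mul₀ hX hg'

theorem setLIntegral_eq_lintegral_mul_of_condExp (hm : m ≤ mΩ) [IsFiniteMeasure P] {E : Set Ω}
    (hE : MeasurableSet E) {k g : Ω → ENNReal} (hk : ∀ ω, k ω ≠ ⊤)
    (h : P⟦E | m⟧ =ᵐ[P] fun ω => (k ω).toReal) (hg : Measurable[m] g) :
    ∫⁻ ω in E, g ω ∂P = ∫⁻ ω, k ω * g ω ∂P := by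
  have hcond : P⁻[E.indicator 1 | m] =ᵐ[P] k := by
    have hfin : ∫⁻ ω, E.indicator 1 ω ∂P ≠ ⊤ := by
      rw [lintegral_indicator_one hE]
      exact measure_ne_top _ _
    have htoReal : (fun ω => (E.indicator (1 : Ω → ENNReal) ω).toReal) =
        E.indicator fun _ => (1 : ℝ) := by
      funext ω
      by_cases hω : ω ∈ E <;> simp [hω]
    have hcondExp : (fun ω => (P⁻[E.indicator 1 | m] ω).toReal) =ᵐ[P] P⟦E | m⟧ := by
      rw [← htoReal]
      exact toReal_condLExp m (aemeasurable_one.indicator hE) hfin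
    filter_upwards [hcondExp, h, condLExp_ne_top (mΩ := m) hfin] with ω hω hkω htop
    exact (ENNReal.toReal_eq_toReal_iff' htop (hk ω)).1 (hω.trans hkω)
  calc ∫⁻ ω in E, g ω ∂P = ∫⁻ ω, E.indicator 1 ω * g ω ∂P := by
        rw [← lintegral_indicator hE]
        exact lintegral_congr fun ω => by
          by_cases hω : ω ∈ E <;> simp [hω]
    _ = ∫⁻ ω, P⁻[E.indicator 1 | m] ω * g ω ∂P :=
        (lintegral_condLExp_mul hm (aemeasurable_one.indicator hE) hg).symm
    _ = ∫⁻ ω, k ω * g ω ∂P := lintegral_congr_ae (hcond.mono fun ω hω => by simp only [hω])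

end ConditionalProbability

theorem integral_logb_toReal_le_logb {Ω : Type*} [MeasurableSpace Ω] {P : Measure Ω}
    [IsProbabilityMeasure P] {Z : Ω → ENNReal} {κ : ℝ} (hκ : 0 < κ) (hZ : AEMeasurable Z P)
    (hZκ : ∫⁻ ω, Z ω ∂P ≤ ENNReal.ofReal κ) (hZ0 : ∀ᵐ ω ∂P, Z ω ≠ 0)
    (hlog : Integrable (fun ω => Real.logb 2 (Z ω).toReal) P) :
    ∫ ω, Real.logb 2 (Z ω).toReal ∂P ≤ Real.logb 2 κ := by
  have hZtop : ∫⁻ ω, Z ω ∂P ≠ ⊤ := ne_top_of_le_ne_top ENNReal.ofReal_ne_top hZκ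
  have hZint : Integrable (fun ω => (Z ω).toReal) P :=
    integrable_toReal_of_lintegral_ne_top hZ hZtop
  have hZle : ∫ ω, (Z ω).toReal ∂P ≤ κ := by
    rw [integral_toReal hZ (ae_lt_top' hZ hZtop)]
    exact ENNReal.toReal_le_of_le_ofReal hκ.le hZκ
  have htangent : ∀ᵐ ω ∂P, Real.logb 2 (Z ω).toReal ≤
      Real.logb 2 κ + ((Z ω).toReal / κ - 1) / Real.log 2 := by
    filter_upwards [hZ0, ae_lt_top' hZ hZtop] with ω hω0 hωtop
    have hpos : 0 < (Z ω).toReal := ENNReal.toReal_pos hω0 hωtop.ne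
    rw [Real.logb, Real.logb, ← add_div]
    refine div_le_div_of_nonneg_right ?_ (Real.log_nonneg one_le_two)
    have := Real.log_le_sub_one_of_pos (div_pos hpos hκ)
    rw [Real.log_div hpos.ne' hκ.ne'] at this
    linarith
  have hlin : Integrable (fun ω => ((Z ω).toReal / κ - 1) / Real.log 2) P :=
    ((hZint.div_const κ).sub (integrable_const 1)).div_const _
  have hmono := integral_mono_ae hlog ((integrable_const _).add hlin) htangent
  rw [integral_add' (integrable_const _) hlin, integral_const, probReal_univ, one_smul,
    integral_div, integral_sub (hZint.div_const κ) (integrable_const 1),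
    integral_div, integral_const, probReal_univ, one_smul] at hmono
  refine hmono.trans (add_le_of_nonpos_right
    (div_nonpos_of_nonpos_of_nonneg ?_ (Real.log_nonneg one_le_two)))
  simpa using div_le_one_of_le₀ hZle hκ.le

theorem preimage_prodMk_singleton {Ω α β : Type*} (X : Ω → α) (Y : Ω → β) (z : α × β) :
    (fun ω => (X ω, Y ω)) ⁻¹' {z} = X ⁻¹' {z.1} ∩ Y ⁻¹' {z.2} := by
  rw [← Set.mk_preimage_prod, Set.singleton_prod_singleton]

theorem lintegral_ofReal_piecewise_inv_le {Ω : Type*} [MeasurableSpace Ω] {P : Measure Ω}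
    [IsProbabilityMeasure P] {D : Set Ω} [∀ ω, Decidable (ω ∈ D)] (hD : MeasurableSet D)
    {ε : ℝ} (hε : 0 < ε) (hDε : P.real D ≤ ε) :
    ∫⁻ ω, ENNReal.ofReal (D.piecewise (fun _ => ε⁻¹) (fun _ => 1) ω) ∂P ≤ ENNReal.ofReal 2 := by
  have hle : ∀ ω, ENNReal.ofReal (D.piecewise (fun _ => ε⁻¹) (fun _ => 1) ω) ≤
      1 + D.indicator (fun _ => ENNReal.ofReal ε⁻¹) ω := fun ω => by
    by_cases hω : ω ∈ D <;> simp [hω]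
  calc ∫⁻ ω, ENNReal.ofReal (D.piecewise (fun _ => ε⁻¹) (fun _ => 1) ω) ∂P
      ≤ ∫⁻ ω, (1 + D.indicator (fun _ => ENNReal.ofReal ε⁻¹) ω) ∂P := lintegral_mono hle
    _ = 1 + ENNReal.ofReal (ε⁻¹ * P.real D) := by
      rw [lintegral_add_left measurable_const, lintegral_indicator_const hD, lintegral_one,
        measure_univ, ENNReal.ofReal_mul (inv_pos.2 hε).le, ofReal_measureReal]
    _ ≤ 1 + ENNReal.ofReal 1 := by
      gcongr
      rwa [inv_mul_le_one₀ hε]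
    _ = ENNReal.ofReal 2 := by
      rw [← ENNReal.ofReal_one, ← ENNReal.ofReal_add one_pos.le one_pos.le, one_add_one_eq_two]

section Histories

variable {Ω α : Type*}

theorem hist_succ_eq_iff (X : ℕ → Ω → α) (n : ℕ) (ω : Ω) (s : Fin (n + 1) → α) :
    hist X (n + 1) ω = s ↔ hist X n ω = Fin.init s ∧ X n ω = s (Fin.last n) := by
  constructor
  · rintro rfl
    exact ⟨rfl, rfl⟩
  · rintro ⟨hinit, hlast⟩
    funext i
    induction i using Fin.lastCases with
    | last => exact hlast
    | cast i => exact congrFun hinit i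

theorem measurable_hist {m : MeasurableSpace Ω} [MeasurableSpace α] {X : ℕ → Ω → α} {n : ℕ}
    (hX : ∀ i < n, Measurable[m] (X i)) : Measurable[m] (hist X n) :=
  measurable_pi_lambda _ fun i => hX i i.isLt

theorem measurable_of_measurable_hist {m : MeasurableSpace Ω} [MeasurableSpace α]
    {X : ℕ → Ω → α} {n i : ℕ} (hX : Measurable[m] (hist X n)) (hi : i < n) : Measurable[m] (X i) :=
  (measurable_pi_apply (⟨i, hi⟩ : Fin n)).comp hX

end Histories

section ChannelPast

variable {Ω A A' : Type*} [MeasurableSpace A] [MeasurableSpace A']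

theorem measurable_hist_input_channelPast (σ : MeasurableSpace Ω) (q : ℕ → Ω → A)
    (q' : ℕ → Ω → A') (t : ℕ) : Measurable[channelPast q q' t ⊔ σ] (hist q (t + 1)) :=
  (comap_measurable _).mono (le_sup_left.trans le_sup_left) le_rfl

theorem measurable_hist_output_channelPast (σ : MeasurableSpace Ω) (q : ℕ → Ω → A)
    (q' : ℕ → Ω → A') (t : ℕ) : Measurable[channelPast q q' t ⊔ σ] (hist q' t) :=
  (comap_measurable _).mono (le_sup_right.trans le_sup_left) le_rfl

end ChannelPast

section Likelihood

variable {Ω A A' : Type*}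

/-- The likelihood `∏_{t<T} P(q'_t | q_{[0,t]}, q'_{[0,t-1]})` of the first `T` outputs of the
channel given its inputs. -/
noncomputable def likelihood (W : Channel A A') (q : ℕ → Ω → A) (q' : ℕ → Ω → A') (T : ℕ)
    (ω : Ω) : ENNReal :=
  ∏ t ∈ Finset.range T, W t (hist q (t + 1) ω) (hist q' t ω) (q' t ω)

variable {W : Channel A A'} {q : ℕ → Ω → A} {q' : ℕ → Ω → A'}

theorem likelihood_ne_top (T : ℕ) (ω : Ω) : likelihood W q q' T ω ≠ ⊤ :=
  ENNReal.prod_ne_top fun _ _ => PMF.apply_ne_top _ _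

theorem likelihood_succ (T : ℕ) (ω : Ω) :
    likelihood W q q' (T + 1) ω =
      likelihood W q q' T ω * W T (hist q (T + 1) ω) (hist q' T ω) (q' T ω) :=
  Finset.prod_range_succ _ _

variable [Countable A] [MeasurableSpace A] [MeasurableSingletonClass A]
  [Countable A'] [MeasurableSpace A'] [MeasurableSingletonClass A'] {m : MeasurableSpace Ω}

theorem measurable_channel {t : ℕ} {b : Ω → A'} (hq : Measurable[m] (hist q (t + 1)))
    (hq' : Measurable[m] (hist q' t)) (hb : Measurable[m] b) :
    Measurable[m] fun ω => W t (hist q (t + 1) ω) (hist q' t ω) (b ω) :=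
  (Measurable.of_discrete
    (f := fun z : (Fin (t + 1) → A) × (Fin t → A') × A' => W t z.1 z.2.1 z.2.2)).comp
    (hq.prodMk (hq'.prodMk hb))

theorem measurable_likelihood {T : ℕ} (hq : ∀ i < T, Measurable[m] (q i))
    (hq' : ∀ i < T, Measurable[m] (q' i)) : Measurable[m] (likelihood W q q' T) :=
  Finset.measurable_fun_prod _ fun t ht =>
    have ht := Finset.mem_range.1 ht
    measurable_channel (measurable_hist fun i hi => hq i (by lia))
      (measurable_hist fun i hi => hq' i (by lia)) (hq' t ht)

end Likelihood

theorem exists_pmf_forall_measure_mul_eq_inter {Ω α : Type*} [MeasurableSpace Ω] {P : Measure Ω}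
    [IsFiniteMeasure P] [Nonempty α] [Countable α] [MeasurableSpace α] [MeasurableSingletonClass α]
    {F : Set Ω} (hF : MeasurableSet F) {X : Ω → α} (hX : Measurable X) :
    ∃ π : PMF α, ∀ c, P F * π c = P (F ∩ X ⁻¹' {c}) := by
  obtain h0 | h0 := eq_or_ne (P F) 0
  · refine ⟨PMF.pure (Classical.arbitrary α), fun c => ?_⟩
    rw [h0, zero_mul, measure_mono_null Set.inter_subset_left h0]
  · have := cond_isProbabilityMeasure h0
    have : IsProbabilityMeasure ((P[|F]).map X) :=
      Measure.isProbabilityMeasure_map hX.aemeasurable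
    refine ⟨((P[|F]).map X).toPMF, fun c => ?_⟩
    rw [Measure.toPMF_apply, Measure.map_apply hX (measurableSet_singleton c), mul_comm,
      cond_mul_eq_inter hF _ P]

theorem eq_snoc_iff {α : Type*} {n : ℕ} {s : Fin (n + 1) → α} {s' : Fin n → α} {z : α} :
    s = Fin.snoc (α := fun _ => α) s' z ↔ s' = Fin.init s ∧ z = s (Fin.last n) := by
  constructor
  · rintro rfl
    simp
  · rintro ⟨rfl, rfl⟩
    simp

theorem jointLaw_succ_apply {A A' : Type*} (W : Channel A A') (π : InputKernels A A') (T : ℕ)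
    (a : Fin (T + 1) → A) (s : Fin (T + 1) → A') :
    jointLaw W π (T + 1) (a, s) = jointLaw W π T (Fin.init a, Fin.init s) *
      (π T (Fin.init a) (Fin.init s) (a (Fin.last T)) *
        W T a (Fin.init s) (s (Fin.last T))) := by
  rw [jointLaw, PMF.bind_apply, tsum_eq_single (Fin.init a, Fin.init s)]
  · rw [PMF.bind_apply, tsum_eq_single (a (Fin.last T))]
    · rw [PMF.map_apply, tsum_eq_single (s (Fin.last T))]
      · simp
      · exact fun b hb => if_neg fun h => hb (eq_snoc_iff.1 (Prod.mk_inj.1 h).2).2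
    · intro c hc
      rw [PMF.map_apply, ENNReal.tsum_eq_zero.2, mul_zero]
      exact fun b => if_neg fun h => hc (eq_snoc_iff.1 (Prod.mk_inj.1 h).1).2
  · intro v hv
    rw [PMF.bind_apply, ENNReal.tsum_eq_zero.2, mul_zero]
    intro c
    rw [PMF.map_apply, ENNReal.tsum_eq_zero.2, mul_zero]
    exact fun b => if_neg fun h => hv (Prod.ext (eq_snoc_iff.1 (Prod.mk_inj.1 h).1).1
      (eq_snoc_iff.1 (Prod.mk_inj.1 h).2).1)

theorem lintegral_eq_tsum_setLIntegral_preimage {Ω α : Type*} [MeasurableSpace Ω] [Countable α]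
    [MeasurableSpace α] [MeasurableSingletonClass α] (P : Measure Ω) {V : Ω → α}
    (hV : Measurable V) (g : Ω → ENNReal) :
    ∫⁻ ω, g ω ∂P = ∑' v, ∫⁻ ω in V ⁻¹' {v}, g ω ∂P := by
  rw [← setLIntegral_univ, ← Set.preimage_univ (f := V), ← Set.iUnion_of_singleton α,
    Set.preimage_iUnion]
  refine lintegral_iUnion (fun v => hV (measurableSet_singleton v)) (fun v v' hv => ?_) g
  exact Disjoint.preimage V (Set.disjoint_singleton.2 hv)

/-- The information density `log₂ (∏_{t<T} P(q'_t | q_{[0,t]}, q'_{[0,t-1]}) / P(q'_{[0,T-1]}))`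
at the realized inputs and outputs. Its expectation is the directed information. -/
noncomputable def infoDensity {Ω A A' : Type*} [MeasurableSpace Ω] (P : Measure Ω)
    (W : Channel A A') (q : ℕ → Ω → A) (q' : ℕ → Ω → A') (T : ℕ) (ω : Ω) : ℝ :=
  Real.logb 2 (likelihood W q q' T ω).toReal - Real.logb 2 (realizedProb P (hist q' T) ω).toReal

theorem infoDensity_zero {Ω A A' : Type*} [MeasurableSpace Ω] (P : Measure Ω)
    [IsProbabilityMeasure P] (W : Channel A A') (q : ℕ → Ω → A) (q' : ℕ → Ω → A') (ω : Ω) :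
    infoDensity P W q q' 0 ω = 0 := by
  have huniv : hist q' 0 ⁻¹' {hist q' 0 ω} = Set.univ :=
    Set.eq_univ_of_forall fun ω' => Subsingleton.elim _ _
  simp [infoDensity, likelihood, realizedProb, huniv]

section ChannelUse

/-- The channel `W` with inputs `q` and outputs `q'` is used in a loop whose exogenous randomness
is recorded by the σ-algebra `σ`: given its own past, the channel selects the next output
according to `W` independently of `σ`. For `σ = ⊥` this only says that `q'` is produced from `q`
by `W`; nothing is required of the way the inputs are chosen. -/
structure IsChannelUse {Ω A A' : Type*} (σ : MeasurableSpace Ω) [mΩ : MeasurableSpace Ω]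
    [MeasurableSpace A] [MeasurableSpace A'] (P : Measure Ω) (W : Channel A A') (q : ℕ → Ω → A)
    (q' : ℕ → Ω → A') : Prop where
  measurable_input : ∀ t, Measurable (q t)
  measurable_output : ∀ t, Measurable (q' t)
  le_ambient : σ ≤ mΩ
  condLaw : ∀ t (b : A'), P⟦q' t ⁻¹' {b} | channelPast q q' t ⊔ σ⟧ =ᵐ[P]
    fun ω => (W t (hist q (t + 1) ω) (hist q' t ω) b).toReal

namespace IsChannelUse

variable {Ω A A' : Type*} {σ : MeasurableSpace Ω} [mΩ : MeasurableSpace Ω] [MeasurableSpace A]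
  [MeasurableSpace A'] {P : Measure Ω} {W : Channel A A'} {q : ℕ → Ω → A} {q' : ℕ → Ω → A'}

theorem measurable_hist_input (h : IsChannelUse σ P W q q') (t : ℕ) : Measurable (hist q t) :=
  measurable_hist fun i _ => h.measurable_input i

theorem measurable_hist_output (h : IsChannelUse σ P W q q') (t : ℕ) : Measurable (hist q' t) :=
  measurable_hist fun i _ => h.measurable_output i

theorem measurable_hist_prodMk (h : IsChannelUse σ P W q q') (t : ℕ) :
    Measurable fun ω => (hist q t ω, hist q' t ω) :=
  (h.measurable_hist_input t).prodMk (h.measurable_hist_output t)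

theorem channelPast_sup_le (h : IsChannelUse σ P W q q') (t : ℕ) : channelPast q q' t ⊔ σ ≤ mΩ :=
  sup_le (sup_le (h.measurable_hist_input _).comap_le (h.measurable_hist_output t).comap_le)
    h.le_ambient

variable [MeasurableSingletonClass A']

theorem setLIntegral_output [IsFiniteMeasure P] (h : IsChannelUse σ P W q q') (t : ℕ) (b : A')
    {g : Ω → ENNReal} (hg : Measurable[channelPast q q' t ⊔ σ] g) :
    ∫⁻ ω in q' t ⁻¹' {b}, g ω ∂P =
      ∫⁻ ω, W t (hist q (t + 1) ω) (hist q' t ω) b * g ω ∂P :=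
  setLIntegral_eq_lintegral_mul_of_condExp (h.channelPast_sup_le t)
    (h.measurable_output t (measurableSet_singleton b)) (fun _ => PMF.apply_ne_top _ _)
    (h.condLaw t b) hg

variable [MeasurableSingletonClass A]

theorem measure_output_inter_eq [IsFiniteMeasure P]
    (h : IsChannelUse σ P W q q') (t : ℕ) (a : Fin (t + 1) → A) (s : Fin t → A') (b : A') :
    P (q' t ⁻¹' {b} ∩ (hist q (t + 1) ⁻¹' {a} ∩ hist q' t ⁻¹' {s})) =
      W t a s b * P (hist q (t + 1) ⁻¹' {a} ∩ hist q' t ⁻¹' {s}) := by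
  set F := hist q (t + 1) ⁻¹' {a} ∩ hist q' t ⁻¹' {s}
  have hF : MeasurableSet[channelPast q q' t ⊔ σ] F := @MeasurableSet.inter _ _ _ _
    (measurable_hist_input_channelPast σ q q' t (measurableSet_singleton a))
    (measurable_hist_output_channelPast σ q q' t (measurableSet_singleton s))
  have hF' : MeasurableSet F := h.channelPast_sup_le t _ hF
  have hmul : ∀ ω, W t (hist q (t + 1) ω) (hist q' t ω) b * F.indicator 1 ω =
      F.indicator (fun _ => W t a s b) ω := fun ω => by
    by_cases hω : ω ∈ F
    · rw [Set.indicator_of_mem hω, Set.indicator_of_mem hω, hω.1, hω.2, Pi.one_apply, mul_one]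
    · rw [Set.indicator_of_notMem hω, Set.indicator_of_notMem hω, mul_zero]
  have hout := h.setLIntegral_output t b (g := F.indicator 1)
    ((measurable_const (a := (1 : ENNReal))).indicator hF)
  rw [lintegral_indicator_one hF', Measure.restrict_apply hF', lintegral_congr hmul,
    lintegral_indicator_const hF'] at hout
  rw [Set.inter_comm, hout]

theorem realizedProb_output_eq [IsFiniteMeasure P] (h : IsChannelUse σ P W q q') (t : ℕ) (ω : Ω) :
    realizedProb P (fun ω => (q' t ω, hist q (t + 1) ω, hist q' t ω)) ω =
      W t (hist q (t + 1) ω) (hist q' t ω) (q' t ω) *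
        realizedProb P (fun ω => (hist q (t + 1) ω, hist q' t ω)) ω := by
  rw [realizedProb, realizedProb, preimage_prodMk_singleton (q' t), preimage_prodMk_singleton,
    h.measure_output_inter_eq]

variable [Countable A] [Countable A']

theorem ae_channel_ne_zero [IsFiniteMeasure P] (h : IsChannelUse σ P W q q') (t : ℕ) :
    ∀ᵐ ω ∂P, W t (hist q (t + 1) ω) (hist q' t ω) (q' t ω) ≠ 0 := by
  filter_upwards [ae_realizedProb_ne_zero P fun ω => (q' t ω, hist q (t + 1) ω, hist q' t ω)]
    with ω hω
  rw [h.realizedProb_output_eq] at hω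
  exact left_ne_zero_of_mul hω

theorem ae_likelihood_ne_zero [IsFiniteMeasure P] (h : IsChannelUse σ P W q q') (T : ℕ) :
    ∀ᵐ ω ∂P, likelihood W q q' T ω ≠ 0 := by
  filter_upwards [ae_all_iff.2 h.ae_channel_ne_zero] with ω hω
  exact Finset.prod_ne_zero_iff.2 fun t _ => hω t

theorem exists_inputKernels [IsProbabilityMeasure P] (h : IsChannelUse σ P W q q') :
    ∃ π : InputKernels A A', ∀ T,
      (jointLaw W π T).toMeasure = P.map fun ω => (hist q T ω, hist q' T ω) := by
  have : Nonempty A := ⟨q 0 P.nonempty_of_neZero.some⟩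
  have hfib : ∀ t (v : (Fin t → A) × (Fin t → A')),
      MeasurableSet ((fun ω => (hist q t ω, hist q' t ω)) ⁻¹' {v}) := fun t v =>
    h.measurable_hist_prodMk t (measurableSet_singleton v)
  choose π hπ using fun t (a : Fin t → A) (s : Fin t → A') =>
    exists_pmf_forall_measure_mul_eq_inter (P := P) (hfib t (a, s)) (h.measurable_input t)
  refine ⟨π, fun T => Measure.ext_of_singleton fun v => ?_⟩
  rw [PMF.toMeasure_apply_singleton _ _ (measurableSet_singleton v),
    Measure.map_apply (h.measurable_hist_prodMk T) (measurableSet_singleton v)]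
  induction T with
  | zero =>
    have huniv : (fun ω => (hist q 0 ω, hist q' 0 ω)) ⁻¹' {v} = Set.univ :=
      Set.eq_univ_of_forall fun ω => Subsingleton.elim _ _
    rw [huniv, measure_univ, jointLaw, Subsingleton.elim v (Fin.elim0, Fin.elim0),
      PMF.pure_apply_self]
  | succ T ih =>
    obtain ⟨a, s⟩ := v
    have hinput : (fun ω => (hist q T ω, hist q' T ω)) ⁻¹' {(Fin.init a, Fin.init s)} ∩
        q T ⁻¹' {a (Fin.last T)} = hist q (T + 1) ⁻¹' {a} ∩ hist q' T ⁻¹' {Fin.init s} := by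
      ext ω
      simp only [hist_succ_eq_iff, Set.mem_inter_iff, Set.mem_preimage, Set.mem_singleton_iff,
        Prod.mk.injEq]
      tauto
    have houtput : (fun ω => (hist q (T + 1) ω, hist q' (T + 1) ω)) ⁻¹' {(a, s)} =
        q' T ⁻¹' {s (Fin.last T)} ∩
          (hist q (T + 1) ⁻¹' {a} ∩ hist q' T ⁻¹' {Fin.init s}) := by
      ext ω
      simp only [hist_succ_eq_iff q', Set.mem_inter_iff, Set.mem_preimage,
        Set.mem_singleton_iff, Prod.mk.injEq]
      tauto
    rw [jointLaw_succ_apply, ih, ← mul_assoc, hπ, hinput, houtput, h.measure_output_inter_eq,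
      mul_comm]

theorem setLIntegral_mul_inv_likelihood_succ_le [IsFiniteMeasure P] (h : IsChannelUse σ P W q q')
    (T : ℕ) (s : Fin (T + 1) → A') {g : Ω → ENNReal} (hg : Measurable[σ] g) :
    ∫⁻ ω in hist q' (T + 1) ⁻¹' {s}, g ω * (likelihood W q q' (T + 1) ω)⁻¹ ∂P ≤
      ∫⁻ ω in hist q' T ⁻¹' {Fin.init s}, g ω * (likelihood W q q' T ω)⁻¹ ∂P := by
  have hq := measurable_hist_input_channelPast σ q q' T
  have hq' := measurable_hist_output_channelPast σ q q' T
  set b := s (Fin.last T)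
  set F := hist q' T ⁻¹' {Fin.init s}
  set k : Ω → ENNReal := fun ω => W T (hist q (T + 1) ω) (hist q' T ω) b
  set G : Ω → ENNReal := fun ω => g ω * (likelihood W q q' T ω)⁻¹
  have hF : MeasurableSet[channelPast q q' T ⊔ σ] F := hq' (measurableSet_singleton _)
  have hF' : MeasurableSet F := h.channelPast_sup_le T _ hF
  have hk : Measurable[channelPast q q' T ⊔ σ] k := measurable_channel hq hq' measurable_const
  have hlik : Measurable[channelPast q q' T ⊔ σ] (likelihood W q q' T) := measurable_likelihood
    (fun i hi => measurable_of_measurable_hist hq (by lia))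
    (fun i hi => measurable_of_measurable_hist hq' hi)
  have hG : Measurable[channelPast q q' T ⊔ σ] G := (hg.mono le_sup_right le_rfl).mul hlik.inv
  have hfib : hist q' (T + 1) ⁻¹' {s} = q' T ⁻¹' {b} ∩ F := by
    ext ω
    exact (hist_succ_eq_iff _ _ _ _).trans and_comm
  have hsucc : ∀ ω ∈ q' T ⁻¹' {b}, g ω * (likelihood W q q' (T + 1) ω)⁻¹ = G ω * (k ω)⁻¹ := by
    intro ω hω
    have hb : q' T ω = b := hω
    rw [likelihood_succ, ENNReal.mul_inv (Or.inr (PMF.apply_ne_top _ _))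
      (Or.inl (likelihood_ne_top T ω)), hb, ← mul_assoc]
  calc ∫⁻ ω in hist q' (T + 1) ⁻¹' {s}, g ω * (likelihood W q q' (T + 1) ω)⁻¹ ∂P
      = ∫⁻ ω in q' T ⁻¹' {b} ∩ F, G ω * (k ω)⁻¹ ∂P := by
        rw [hfib]
        exact setLIntegral_congr_fun ((h.measurable_output T (measurableSet_singleton b)).inter
          hF') fun ω hω => hsucc ω hω.1
    _ = ∫⁻ ω in q' T ⁻¹' {b}, F.indicator (fun ω => G ω * (k ω)⁻¹) ω ∂P := by
        rw [setLIntegral_indicator hF', Set.inter_comm]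
    _ = ∫⁻ ω, k ω * F.indicator (fun ω => G ω * (k ω)⁻¹) ω ∂P :=
        h.setLIntegral_output T b ((hG.mul hk.inv).indicator hF)
    _ ≤ ∫⁻ ω, F.indicator G ω ∂P := lintegral_mono fun ω => by
        rw [← Set.indicator_mul_right]
        refine Set.indicator_le_indicator ?_
        simpa only [mul_left_comm] using mul_le_of_le_one_right' (ENNReal.mul_inv_le_one _)
    _ = ∫⁻ ω in F, G ω ∂P := lintegral_indicator hF' _

theorem setLIntegral_mul_inv_likelihood_le [IsFiniteMeasure P] (h : IsChannelUse σ P W q q')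
    (T : ℕ) (s : Fin T → A') {g : Ω → ENNReal} (hg : Measurable[σ] g) :
    ∫⁻ ω in hist q' T ⁻¹' {s}, g ω * (likelihood W q q' T ω)⁻¹ ∂P ≤ ∫⁻ ω, g ω ∂P := by
  induction T with
  | zero =>
    refine (setLIntegral_le_lintegral _ _).trans_eq (lintegral_congr fun ω => ?_)
    simp [likelihood]
  | succ T ih => exact (h.setLIntegral_mul_inv_likelihood_succ_le T s hg).trans (ih _)

theorem lintegral_realizedProb_mul_inv_likelihood_le [IsProbabilityMeasure P]
    (h : IsChannelUse σ P W q q') (T : ℕ) {g : (Fin T → A') → Ω → ENNReal}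
    (hg : ∀ s, Measurable[σ] (g s)) {κ : ENNReal} (hκ : ∀ s, ∫⁻ ω, g s ω ∂P ≤ κ) :
    ∫⁻ ω, realizedProb P (hist q' T) ω * (g (hist q' T ω) ω * (likelihood W q q' T ω)⁻¹) ∂P ≤
      κ := by
  have hV := h.measurable_hist_output T
  have hfib : ∀ s, ∫⁻ ω in hist q' T ⁻¹' {s}, realizedProb P (hist q' T) ω *
      (g (hist q' T ω) ω * (likelihood W q q' T ω)⁻¹) ∂P ≤ P (hist q' T ⁻¹' {s}) * κ := fun s =>
    calc ∫⁻ ω in hist q' T ⁻¹' {s}, realizedProb P (hist q' T) ω *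
          (g (hist q' T ω) ω * (likelihood W q q' T ω)⁻¹) ∂P
        = ∫⁻ ω in hist q' T ⁻¹' {s}, P (hist q' T ⁻¹' {s}) *
            (g s ω * (likelihood W q q' T ω)⁻¹) ∂P :=
          setLIntegral_congr_fun (hV (measurableSet_singleton s)) fun ω hω => by
            have hs : hist q' T ω = s := hω
            simp only [realizedProb, hs]
      _ = P (hist q' T ⁻¹' {s}) *
            ∫⁻ ω in hist q' T ⁻¹' {s}, g s ω * (likelihood W q q' T ω)⁻¹ ∂P :=
          lintegral_const_mul' _ _ (measure_ne_top _ _)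
      _ ≤ P (hist q' T ⁻¹' {s}) * κ :=
          mul_le_mul_right ((h.setLIntegral_mul_inv_likelihood_le T s (hg s)).trans (hκ s)) _
  have hone : ∑' s, P (hist q' T ⁻¹' {s}) = 1 := by
    simpa using (lintegral_eq_tsum_setLIntegral_preimage P hV 1).symm
  rw [lintegral_eq_tsum_setLIntegral_preimage P hV]
  refine (ENNReal.tsum_le_tsum hfib).trans_eq ?_
  rw [ENNReal.tsum_mul_right, hone, one_mul]

theorem infoDensity_succ_sub [IsFiniteMeasure P] (h : IsChannelUse σ P W q q') (t : ℕ) :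
    ∀ᵐ ω ∂P, infoDensity P W q q' (t + 1) ω - infoDensity P W q q' t ω =
      (Real.logb 2
          (realizedProb P (fun ω => (q' t ω, hist q (t + 1) ω, hist q' t ω)) ω).toReal -
        Real.logb 2 (realizedProb P (fun ω => (hist q (t + 1) ω, hist q' t ω)) ω).toReal) -
      (Real.logb 2 (realizedProb P (fun ω => (q' t ω, hist q' t ω)) ω).toReal -
        Real.logb 2 (realizedProb P (hist q' t) ω).toReal) := by
  have hout : realizedProb P (fun ω => (q' t ω, hist q' t ω)) =
      realizedProb P (hist q' (t + 1)) :=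
    realizedProb_eq_of_eq_iff P fun ω ω' => by
      rw [hist_succ_eq_iff, Prod.mk_inj, and_comm]
      rfl
  filter_upwards [h.ae_likelihood_ne_zero t, h.ae_channel_ne_zero t,
    ae_realizedProb_ne_zero P fun ω => (hist q (t + 1) ω, hist q' t ω)] with ω hlik hW hpast
  have htoReal {a : ENNReal} (ha : a ≠ 0) (ha' : a ≠ ⊤) : a.toReal ≠ 0 :=
    ENNReal.toReal_ne_zero.2 ⟨ha, ha'⟩
  rw [h.realizedProb_output_eq, hout, infoDensity, infoDensity, likelihood_succ,
    ENNReal.toReal_mul, ENNReal.toReal_mul,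
    Real.logb_mul (htoReal hlik (likelihood_ne_top t ω)) (htoReal hW (PMF.apply_ne_top _ _)),
    Real.logb_mul (htoReal hW (PMF.apply_ne_top _ _)) (htoReal hpast (realizedProb_ne_top P _ ω))]
  ring

end IsChannelUse

end ChannelUse

section DirectedInformation

namespace IsChannelUse

variable {Ω A A' : Type*} {σ : MeasurableSpace Ω} [MeasurableSpace Ω]
  [MeasurableSpace A] [MeasurableSingletonClass A] [MeasurableSpace A']
  [MeasurableSingletonClass A'] {P : Measure Ω} {W : Channel A A'} {q : ℕ → Ω → A}
  {q' : ℕ → Ω → A'}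

theorem integrable_infoDensity [Finite A] [Finite A'] [IsFiniteMeasure P]
    (h : IsChannelUse σ P W q q') (T : ℕ) :
    Integrable (infoDensity P W q q' T) P := by
  have hlik : Integrable (fun ω => Real.logb 2 (likelihood W q q' T ω).toReal) P := by
    simp only [likelihood, Finset.prod_range]
    exact integrable_comp_of_finite (α := (t : Fin T) → (Fin (t + 1) → A) × (Fin t → A') × A') P
      (V := fun ω (t : Fin T) => (hist q (t + 1) ω, hist q' t ω, q' t ω))
      (measurable_pi_lambda _ fun t => (h.measurable_hist_input _).prodMk
        ((h.measurable_hist_output _).prodMk (h.measurable_output t)))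
      fun v => Real.logb 2 (∏ t : Fin T, W t (v t).1 (v t).2.1 (v t).2.2).toReal
  exact hlik.sub (integrable_logb_realizedProb P (h.measurable_hist_output T))

variable [Fintype A] [Fintype A'] [IsProbabilityMeasure P]

theorem directedInfo_eq_integral_infoDensity (h : IsChannelUse σ P W q q') {T : ℕ}
    {p : PMF ((Fin T → A) × (Fin T → A'))}
    (hp : p.toMeasure = P.map fun ω => (hist q T ω, hist q' T ω)) :
    directedInfo p = ∫ ω, infoDensity P W q q' T ω ∂P := by
  have hterm : ∀ t : Fin T, condMutualInfo p
      (fun v (i : Fin (t + 1)) => v.1 (Fin.castLE t.isLt i)) (fun v => v.2 t)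
      (fun v (i : Fin t) => v.2 (Fin.castLE t.isLt.le i)) =
      ∫ ω, infoDensity P W q q' (t + 1) ω ∂P - ∫ ω, infoDensity P W q q' t ω ∂P := by
    intro t
    rw [← integral_sub (h.integrable_infoDensity _) (h.integrable_infoDensity _),
      integral_congr_ae (h.infoDensity_succ_sub t)]
    exact condMutualInfo_eq_integral (h.measurable_hist_prodMk T) hp _ _ _
  rw [directedInfo, Finset.sum_congr rfl fun t _ => hterm t,
    Fin.sum_univ_eq_sum_range fun t => ∫ ω, infoDensity P W q q' (t + 1) ω ∂P -
      ∫ ω, infoDensity P W q q' t ω ∂P,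
    Finset.sum_range_sub fun t => ∫ ω, infoDensity P W q q' t ω ∂P]
  simp only [infoDensity_zero, integral_zero, sub_zero]

theorem integral_logb_le_directedInfo_add (h : IsChannelUse σ P W q q') {T : ℕ}
    {p : PMF ((Fin T → A) × (Fin T → A'))}
    (hp : p.toMeasure = P.map fun ω => (hist q T ω, hist q' T ω))
    {g : (Fin T → A') → Ω → ℝ} (hg : ∀ s, Measurable[σ] (g s)) (hpos : ∀ s ω, 0 < g s ω)
    {κ : ℝ} (hκ : 0 < κ) (hgκ : ∀ s, ∫⁻ ω, ENNReal.ofReal (g s ω) ∂P ≤ ENNReal.ofReal κ)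
    (hlog : Integrable (fun ω => Real.logb 2 (g (hist q' T ω) ω)) P) :
    ∫ ω, Real.logb 2 (g (hist q' T ω) ω) ∂P ≤ directedInfo p + Real.logb 2 κ := by
  have hV := h.measurable_hist_output T
  set Z : Ω → ENNReal := fun ω => realizedProb P (hist q' T) ω *
    (ENNReal.ofReal (g (hist q' T ω) ω) * (likelihood W q q' T ω)⁻¹)
  have hZ : Measurable Z := by
    have hrp : Measurable (realizedProb P (hist q' T)) :=
      (Measurable.of_discrete (f := fun s => P (hist q' T ⁻¹' {s}))).comp hV
    have hg' : Measurable fun ω => g (hist q' T ω) ω :=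
      (measurable_from_prod_countable_right (f := Function.uncurry g) fun s =>
        (hg s).mono h.le_ambient le_rfl).comp (hV.prodMk measurable_id)
    exact hrp.mul (hg'.ennreal_ofReal.mul (measurable_likelihood (fun i _ => h.measurable_input i)
      fun i _ => h.measurable_output i).inv)
  have hZκ : ∫⁻ ω, Z ω ∂P ≤ ENNReal.ofReal κ :=
    h.lintegral_realizedProb_mul_inv_likelihood_le T (fun s => (hg s).ennreal_ofReal) hgκ
  have hZ0 : ∀ᵐ ω ∂P, Z ω ≠ 0 := by
    filter_upwards [ae_realizedProb_ne_zero P (hist q' T)] with ω hω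
    exact mul_ne_zero hω (mul_ne_zero (ENNReal.ofReal_pos.2 (hpos _ _)).ne'
      (ENNReal.inv_ne_zero.2 (likelihood_ne_top T ω)))
  have hZlog : (fun ω => Real.logb 2 (g (hist q' T ω) ω) - infoDensity P W q q' T ω) =ᵐ[P]
      fun ω => Real.logb 2 (Z ω).toReal := by
    filter_upwards [ae_realizedProb_ne_zero P (hist q' T), h.ae_likelihood_ne_zero T]
      with ω hrp hlik
    have hrp' := (ENNReal.toReal_pos hrp (realizedProb_ne_top P _ ω)).ne'
    have hlik' := (ENNReal.toReal_pos hlik (likelihood_ne_top T ω)).ne'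
    rw [ENNReal.toReal_mul, ENNReal.toReal_mul, ENNReal.toReal_inv,
      ENNReal.toReal_ofReal (hpos _ _).le,
      Real.logb_mul hrp' (mul_ne_zero (hpos _ _).ne' (inv_ne_zero hlik')),
      Real.logb_mul (hpos _ _).ne' (inv_ne_zero hlik'), Real.logb_inv, infoDensity]
    ring
  have hint := hlog.sub (h.integrable_infoDensity T)
  have hle := integral_logb_toReal_le_logb hκ hZ.aemeasurable hZκ hZ0 (hint.congr hZlog)
  rw [← integral_congr_ae hZlog, integral_sub hlog (h.integrable_infoDensity T),
    ← h.directedInfo_eq_integral_infoDensity hp] at hle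
  linarith

theorem measureReal_mem_mul_logb_inv_le (h : IsChannelUse σ P W q q') {T : ℕ}
    {D : (Fin T → A') → Set Ω} (hD : ∀ s, MeasurableSet[σ] (D s)) {ε : ℝ} (hε : 0 < ε)
    (hDε : ∀ s, P.real (D s) ≤ ε) :
    P.real {ω | ω ∈ D (hist q' T ω)} * Real.logb 2 ε⁻¹ ≤ T * maxDirectedInfoRate W T + 1 := by
  classical
  set E : Set Ω := {ω | ω ∈ D (hist q' T ω)}
  have hE : MeasurableSet E := by
    have hE_eq : E = ⋃ s, hist q' T ⁻¹' {s} ∩ D s := by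
      ext ω
      simp [E]
    rw [hE_eq]
    exact MeasurableSet.iUnion fun s =>
      (h.measurable_hist_output T (measurableSet_singleton s)).inter (h.le_ambient _ (hD s))
  set g : (Fin T → A') → Ω → ℝ := fun s => (D s).piecewise (fun _ => ε⁻¹) fun _ => 1
  have hg : ∀ s, Measurable[σ] (g s) := fun s =>
    Measurable.piecewise (hD s) measurable_const measurable_const
  have hpos : ∀ s ω, 0 < g s ω := fun s ω => by
    by_cases hω : ω ∈ D s <;> simp [g, hω, hε]
  have hg_le : ∀ s, ∫⁻ ω, ENNReal.ofReal (g s ω) ∂P ≤ ENNReal.ofReal 2 := fun s =>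
    lintegral_ofReal_piecewise_inv_le (h.le_ambient _ (hD s)) hε (hDε s)
  have hlog : (fun ω => Real.logb 2 (g (hist q' T ω) ω)) =
      E.indicator fun _ => Real.logb 2 ε⁻¹ := by
    funext ω
    by_cases hω : ω ∈ D (hist q' T ω) <;> simp [g, E, hω]
  obtain ⟨π, hπ⟩ := h.exists_inputKernels
  have hle := h.integral_logb_le_directedInfo_add (hπ T) hg hpos two_pos hg_le
    (hlog ▸ (integrable_const _).indicator hE)
  rw [hlog, integral_indicator_const _ hE, smul_eq_mul,
    Real.logb_self_eq_one one_lt_two] at hle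
  linarith [directedInfo_jointLaw_le W π T]

theorem capacity_nonneg (h : IsChannelUse σ P W q q') {C : ℝ}
    (hC : Tendsto (maxDirectedInfoRate W) atTop (𝓝 C)) : 0 ≤ C := by
  have hlim : Tendsto (fun T : ℕ => maxDirectedInfoRate W T + 1 / (T : ℝ)) atTop (𝓝 C) := by
    simpa only [add_zero] using hC.add tendsto_one_div_atTop_nhds_zero_nat
  refine ge_of_tendsto hlim ((eventually_gt_atTop 0).mono fun T hT => ?_)
  have hT : (0 : ℝ) < T := Nat.cast_pos.2 hT
  have hrate := h.measureReal_mem_mul_logb_inv_le (T := T) (D := fun _ => ∅)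
    (fun _ => @MeasurableSet.empty Ω σ) one_pos (by simp)
  rw [inv_one, Real.logb_one, mul_zero] at hrate
  rw [← mul_nonneg_iff_of_pos_left hT, mul_add, mul_one_div_cancel hT.ne']
  exact hrate

end IsChannelUse

end DirectedInformation

section Dynamics

variable {E : Type*} [NormedAddCommGroup E]

/-- The orbit `y ↦ f y + d 0 ↦ f (f y + d 0) + d 1 ↦ …` of `y` under the map `f` driven by the
sequence `d`. -/
def drivenOrbit (f : E → E) (d : ℕ → E) (y : E) : ℕ → E
  | 0 => y
  | T + 1 => f (drivenOrbit f d y T) + d T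

theorem eq_drivenOrbit {f : E → E} {d x : ℕ → E} {T : ℕ}
    (hx : ∀ t < T, x (t + 1) = f (x t) + d t) : x T = drivenOrbit f d (x 0) T := by
  induction T with
  | zero => rfl
  | succ T ih => rw [hx T T.lt_succ_self, ih fun t ht => hx t (ht.trans T.lt_succ_self),
      drivenOrbit]

variable [MeasurableSpace E] [BorelSpace E]

theorem measurable_drivenOrbit [SecondCountableTopology E] {f : E → E} (hf : Measurable f) (T : ℕ) :
    Measurable fun z : E × (ℕ → E) => drivenOrbit f z.2 z.1 T := by
  induction T with
  | zero => exact measurable_fst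
  | succ T ih => exact (hf.comp ih).add ((measurable_pi_apply T).comp measurable_snd)

variable [NormedSpace ℝ E] [FiniteDimensional ℝ E] (μ : Measure E) [μ.IsAddHaarMeasure]
  {f : E → E} {c : ENNReal}

theorem mul_measure_preimage_le (hf : ContDiff ℝ 1 f) (hinj : Function.Injective f)
    (hc : ∀ y, c ≤ ENNReal.ofReal |(fderiv ℝ f y).det|) {D : Set E} (hD : MeasurableSet D) :
    c * μ (f ⁻¹' D) ≤ μ D := by
  have hderiv : ∀ y ∈ f ⁻¹' D, HasFDerivWithinAt f (fderiv ℝ f y) (f ⁻¹' D) y := fun y _ =>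
    (hf.differentiable one_ne_zero y).hasFDerivAt.hasFDerivWithinAt
  calc c * μ (f ⁻¹' D) = ∫⁻ _ in f ⁻¹' D, c ∂μ := (setLIntegral_const _ _).symm
    _ ≤ ∫⁻ y in f ⁻¹' D, ENNReal.ofReal |(fderiv ℝ f y).det| ∂μ := lintegral_mono hc
    _ = μ (f '' (f ⁻¹' D)) := lintegral_abs_det_fderiv_eq_addHaar_image μ
        (hf.continuous.measurable hD) hderiv hinj.injOn
    _ ≤ μ D := measure_mono (Set.image_preimage_subset _ _)

theorem pow_mul_measure_drivenOrbit_mem_le (hf : ContDiff ℝ 1 f) (hinj : Function.Injective f)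
    (hc : ∀ y, c ≤ ENNReal.ofReal |(fderiv ℝ f y).det|) (d : ℕ → E) (T : ℕ) {D : Set E}
    (hD : MeasurableSet D) : c ^ T * μ {y | drivenOrbit f d y T ∈ D} ≤ μ D := by
  induction T generalizing D with
  | zero => simp [drivenOrbit]
  | succ T ih =>
    have hD' : MeasurableSet ((· + d T) ⁻¹' D) := measurable_add_const (d T) hD
    calc c ^ (T + 1) * μ {y | drivenOrbit f d y (T + 1) ∈ D}
        = c * (c ^ T * μ {y | drivenOrbit f d y T ∈ f ⁻¹' ((· + d T) ⁻¹' D)}) := by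
          rw [pow_succ', mul_assoc]
          rfl
      _ ≤ c * μ (f ⁻¹' ((· + d T) ⁻¹' D)) := by
          gcongr
          exact ih (hf.continuous.measurable hD')
      _ ≤ μ ((· + d T) ⁻¹' D) := mul_measure_preimage_le μ hf hinj hc hD'
      _ = μ D := measure_preimage_add_right μ (d T) D

end Dynamics

section Probability

theorem measure_prodMk_mem_le_of_indepFun {Ω α β : Type*} [MeasurableSpace Ω] [MeasurableSpace α]
    [MeasurableSpace β] {P : Measure Ω} [IsProbabilityMeasure P] {X : Ω → α} {Y : Ω → β}
    (hX : Measurable X) (hY : Measurable Y) (hXY : IndepFun X Y P) {D : Set (α × β)}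
    (hD : MeasurableSet D) {κ : ENNReal} (hκ : ∀ v, P.map X {y | (y, v) ∈ D} ≤ κ) :
    P {ω | (X ω, Y ω) ∈ D} ≤ κ := by
  have hmap := (indepFun_iff_map_prod_eq_prod_map_map hX.aemeasurable hY.aemeasurable).1 hXY
  have : IsProbabilityMeasure (P.map X) := Measure.isProbabilityMeasure_map hX.aemeasurable
  have : IsProbabilityMeasure (P.map Y) := Measure.isProbabilityMeasure_map hY.aemeasurable
  calc P {ω | (X ω, Y ω) ∈ D} = P.map (fun ω => (X ω, Y ω)) D :=
        (Measure.map_apply (hX.prodMk hY) hD).symm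
    _ = ∫⁻ v, P.map X {y | (y, v) ∈ D} ∂(P.map Y) := by
        rw [hmap, Measure.prod_apply_symm hD]
        rfl
    _ ≤ ∫⁻ _, κ ∂(P.map Y) := lintegral_mono hκ
    _ = κ := by rw [lintegral_const, measure_univ, mul_one]

theorem exists_measurableSet_restrict_le_smul {α : Type*} [MeasurableSpace α] {μ ρ : Measure α}
    [SigmaFinite μ] [IsFiniteMeasure ρ] (hρ : ρ ≪ μ) {η : ENNReal} (hη : 0 < η) :
    ∃ K : ℕ, 0 < K ∧ ∃ G, MeasurableSet G ∧ ρ Gᶜ ≤ η ∧ ρ.restrict G ≤ K • μ := by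
  set p := ρ.rnDeriv μ
  have hG : ∀ n : ℕ, MeasurableSet {y | p y ≤ n} := fun n =>
    measurableSet_le (Measure.measurable_rnDeriv _ _) measurable_const
  have hanti : Antitone fun n : ℕ => {y | p y ≤ n}ᶜ := fun n k hnk =>
    Set.compl_subset_compl.2 fun y (hy : p y ≤ n) => hy.trans (Nat.cast_le.2 hnk)
  have hnull : ρ (⋂ n : ℕ, {y | p y ≤ n}ᶜ) = 0 := by
    have hfin : ρ {y | ¬p y < ⊤} = 0 := ae_iff.1 (hρ.ae_le (Measure.rnDeriv_lt_top ρ μ))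
    refine measure_mono_null (fun y hy => ?_) hfin
    intro hy'
    obtain ⟨n, hn⟩ := ENNReal.exists_nat_gt hy'.ne
    exact Set.mem_iInter.1 hy n hn.le
  have hlim : Tendsto (fun n : ℕ => ρ {y | p y ≤ n}ᶜ) atTop (𝓝 0) := hnull ▸
    tendsto_measure_iInter_atTop (fun n => (hG n).compl.nullMeasurableSet) hanti
      ⟨0, measure_ne_top _ _⟩
  obtain ⟨n, hnη, hn⟩ := ((hlim.eventually (ge_mem_nhds hη)).and (eventually_gt_atTop 0)).exists
  refine ⟨n, hn, _, hG n, hnη, Measure.le_iff.2 fun D hD => ?_⟩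
  calc ρ.restrict {y | p y ≤ n} D = ∫⁻ y in D ∩ {y | p y ≤ n}, p y ∂μ := by
        rw [Measure.restrict_apply hD, Measure.setLIntegral_rnDeriv hρ]
    _ ≤ ∫⁻ _ in D ∩ {y | p y ≤ n}, (n : ENNReal) ∂μ :=
        setLIntegral_mono measurable_const fun y hy => hy.2
    _ ≤ n * μ D := by
        rw [setLIntegral_const]
        gcongr
        exact Set.inter_subset_left
    _ = (n • μ) D := by rw [Measure.smul_apply, nsmul_eq_mul]

end Probability

theorem logb_two_inv_mul_pow_div_rpow_pow {κ r : ℝ} (hκ : 0 < κ) (hr : 0 < r) (L : ℝ) (n T : ℕ) :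
    Real.logb 2 (κ * r ^ n / ((2 : ℝ) ^ L) ^ T)⁻¹ =
      T * L - n * Real.logb 2 r - Real.logb 2 κ := by
  rw [Real.logb_inv, Real.logb_div (by positivity) (by positivity),
    Real.logb_mul hκ.ne' (by positivity), Real.logb_pow, Real.logb_pow,
    Real.logb_rpow two_pos one_lt_two.ne']
  ring

section ControlledState

/-- The controls issued by the control laws `g` along the output string `s`; the value is `0` at
times which the string does not reach. -/
def controlAlong {A' E : Type*} [Zero E] (g : (t : ℕ) → (Fin (t + 1) → A') → E) {T : ℕ}
    (s : Fin T → A') (t : ℕ) : E :=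
  if h : t < T then g t fun i => s (Fin.castLE h i) else 0

variable {Ω A A' E : Type*} [NormedAddCommGroup E] {f : E → E}
  {g : (t : ℕ) → (Fin (t + 1) → A') → E} {x w : ℕ → Ω → E} {q : ℕ → Ω → A} {q' : ℕ → Ω → A'}

theorem state_eq_drivenOrbit
    (hstate : ∀ t ω, x (t + 1) ω = f (x t ω) + g t (hist q' (t + 1) ω) + w t ω) (T : ℕ) (ω : Ω) :
    x T ω = drivenOrbit f (controlAlong g (hist q' T ω) + fun t => w t ω) (x 0 ω) T :=
  eq_drivenOrbit (x := fun t => x t ω) fun t ht => by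
    rw [Pi.add_apply, controlAlong, dif_pos ht, ← add_assoc]
    exact hstate t ω

variable [NormedSpace ℝ E] [FiniteDimensional ℝ E] [MeasurableSpace E] [BorelSpace E]

theorem measurableSet_drivenOrbit_norm_le (hf : Measurable f) {G : Set E} (hG : MeasurableSet G)
    (a : ℕ → E) (T : ℕ) (r : ℝ) :
    MeasurableSet {z : E × (ℕ → E) | z.1 ∈ G ∧ ‖drivenOrbit f (a + z.2) z.1 T‖ ≤ r} := by
  have horbit : Measurable fun z : E × (ℕ → E) => drivenOrbit f (a + z.2) z.1 T :=
    (measurable_drivenOrbit hf T).comp (measurable_fst.prodMk (measurable_snd.const_add a))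
  exact (measurable_fst hG).inter (measurableSet_le horbit.norm measurable_const)

variable [MeasurableSpace Ω] {P : Measure Ω} [IsProbabilityMeasure P] {μ : Measure E}
  [μ.IsAddHaarMeasure] {G : Set E} {K : ℕ} {L r : ℝ} {T : ℕ}

theorem measure_drivenOrbit_norm_le {X : Ω → E} {Y : Ω → ℕ → E} (hX : Measurable X)
    (hY : Measurable Y) (hXY : IndepFun X Y P) (hf : ContDiff ℝ 1 f)
    (hinj : Function.Injective f) {c : ENNReal} (hc₀ : c ≠ 0) (hc_top : c ≠ ⊤)
    (hc : ∀ y, c ≤ ENNReal.ofReal |(fderiv ℝ f y).det|) (hG : MeasurableSet G)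
    (hGK : (P.map X).restrict G ≤ K • μ) (a : ℕ → E) :
    P {ω | X ω ∈ G ∧ ‖drivenOrbit f (a + Y ω) (X ω) T‖ ≤ r} ≤
      K * (μ (Metric.closedBall 0 r) / c ^ T) := by
  have hmeas := measurableSet_drivenOrbit_norm_le hf.continuous.measurable hG a T r
  refine measure_prodMk_mem_le_of_indepFun hX hY hXY hmeas fun v => ?_
  set D := {y | drivenOrbit f (a + v) y T ∈ Metric.closedBall 0 r}
  have hvol : μ D ≤ μ (Metric.closedBall 0 r) / c ^ T := by
    rw [ENNReal.le_div_iff_mul_le (.inl (pow_ne_zero _ hc₀)) (.inl (ENNReal.pow_ne_top hc_top)),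
      mul_comm]
    exact pow_mul_measure_drivenOrbit_mem_le μ hf hinj hc _ T measurableSet_closedBall
  have hfiber : {y | y ∈ G ∧ ‖drivenOrbit f (a + v) y T‖ ≤ r} = D ∩ G := by
    ext y
    simp [D, and_comm]
  calc P.map X {y | y ∈ G ∧ ‖drivenOrbit f (a + v) y T‖ ≤ r}
      = (P.map X).restrict G D := by rw [hfiber, Measure.restrict_apply' hG]
    _ ≤ K * μ D := by simpa using hGK D
    _ ≤ K * (μ (Metric.closedBall 0 r) / c ^ T) := by gcongr

theorem measureReal_drivenOrbit_norm_le {X : Ω → E} {Y : Ω → ℕ → E} (hX : Measurable X)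
    (hY : Measurable Y) (hXY : IndepFun X Y P) (hf : ContDiff ℝ 1 f)
    (hinj : Function.Injective f) (hL : ∀ y, (2 : ℝ) ^ L ≤ |(fderiv ℝ f y).det|)
    (hG : MeasurableSet G) (hGK : (P.map X).restrict G ≤ K • μ) (hr : 0 ≤ r) (a : ℕ → E) :
    P.real {ω | X ω ∈ G ∧ ‖drivenOrbit f (a + Y ω) (X ω) T‖ ≤ r} ≤
      K * μ.real (Metric.ball 0 1) * r ^ Module.finrank ℝ E / ((2 : ℝ) ^ L) ^ T := by
  have hL₀ : 0 < (2 : ℝ) ^ L := Real.rpow_pos_of_pos two_pos L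
  have hball : μ.real (Metric.closedBall 0 r) =
      μ.real (Metric.ball 0 1) * r ^ Module.finrank ℝ E := by
    rw [measureReal_def, Measure.addHaar_closedBall μ 0 hr, ENNReal.toReal_mul,
      ENNReal.toReal_ofReal (by positivity), measureReal_def, mul_comm]
  refine ENNReal.toReal_le_of_le_ofReal (by positivity)
    ((measure_drivenOrbit_norm_le hX hY hXY hf hinj (ENNReal.ofReal_pos.2 hL₀).ne'
      ENNReal.ofReal_ne_top (fun y => ENNReal.ofReal_le_ofReal (hL y)) hG hGK a).trans_eq ?_)
  rw [mul_assoc, ← hball, mul_div_assoc, ENNReal.ofReal_mul K.cast_nonneg, ENNReal.ofReal_natCast,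
    ENNReal.ofReal_div_of_pos (by positivity),
    ofReal_measureReal measure_closedBall_lt_top.ne, ENNReal.ofReal_pow hL₀.le]

variable [Fintype A] [MeasurableSpace A] [MeasurableSingletonClass A] [Fintype A']
  [MeasurableSpace A'] [MeasurableSingletonClass A'] {W : Channel A A'}

theorem IsChannelUse.measureReal_state_norm_le_mul_le
    (h : IsChannelUse (.comap (x 0) inferInstance ⊔ .comap (fun ω t => w t ω) inferInstance)
      P W q q') (hx : Measurable (x 0)) (hw : ∀ t, Measurable (w t))
    (hxw : IndepFun (x 0) (fun ω t => w t ω) P)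
    (hstate : ∀ t ω, x (t + 1) ω = f (x t ω) + g t (hist q' (t + 1) ω) + w t ω)
    (hf : ContDiff ℝ 1 f) (hinj : Function.Injective f)
    (hL : ∀ y, (2 : ℝ) ^ L ≤ |(fderiv ℝ f y).det|) (hG : MeasurableSet G) (hK : 0 < K)
    (hGK : (P.map (x 0)).restrict G ≤ K • μ) (hr : 0 < r) :
    P.real {ω | x 0 ω ∈ G ∧ ‖x T ω‖ ≤ r} * (T * L - Module.finrank ℝ E * Real.logb 2 r -
      Real.logb 2 (K * μ.real (Metric.ball 0 1))) ≤ T * maxDirectedInfoRate W T + 1 := by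
  set Y : Ω → ℕ → E := fun ω t => w t ω
  set z : Ω → E × (ℕ → E) := fun ω => (x 0 ω, Y ω)
  set D : (Fin T → A') → Set Ω := fun s =>
    z ⁻¹' {z | z.1 ∈ G ∧ ‖drivenOrbit f (controlAlong g s + z.2) z.1 T‖ ≤ r}
  have hz : Measurable[.comap (x 0) inferInstance ⊔ .comap Y inferInstance] z :=
    Measurable.prodMk ((comap_measurable (x 0)).mono le_sup_left le_rfl)
      ((comap_measurable Y).mono le_sup_right le_rfl)
  have hD : ∀ s, MeasurableSet[.comap (x 0) inferInstance ⊔ .comap Y inferInstance] (D s) :=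
    fun s => hz (measurableSet_drivenOrbit_norm_le hf.continuous.measurable hG _ T r)
  have hDε := fun s : Fin T → A' => measureReal_drivenOrbit_norm_le (T := T) hx
    (measurable_pi_lambda Y hw) hxw hf hinj hL hG hGK hr.le (controlAlong g s)
  have hset : {ω | x 0 ω ∈ G ∧ ‖x T ω‖ ≤ r} = {ω | ω ∈ D (hist q' T ω)} := by
    ext ω
    simp only [Set.mem_ofPred_eq, state_eq_drivenOrbit hstate T ω, D, z, Y, Set.mem_preimage]
  have hv : 0 < μ.real (Metric.ball 0 1) :=
    ENNReal.toReal_pos (Metric.measure_ball_pos μ 0 one_pos).ne' measure_ball_lt_top.ne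
  have hKv : 0 < K * μ.real (Metric.ball 0 1) := mul_pos (Nat.cast_pos.2 hK) hv
  rw [← logb_two_inv_mul_pow_div_rpow_pow hKv hr, hset]
  exact h.measureReal_mem_mul_logb_inv_le hD (by positivity) hDε

end ControlledState

section Asymptotics

theorem eventually_le_of_mul_le {u d ρ : ℕ → ℝ} {c D z : ℝ} (hd : Tendsto d atTop (𝓝 D))
    (hρ : Tendsto ρ atTop (𝓝 c)) (hD : 0 < D) (hmul : ∀ᶠ T in atTop, u T * d T ≤ ρ T)
    (hz : c / D < z) : ∀ᶠ T in atTop, u T ≤ z := by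
  filter_upwards [hmul, hd.eventually (lt_mem_nhds hD),
    (hρ.div hd hD.ne').eventually (ge_mem_nhds hz)] with T hmulT hdT hdiv
  exact ((le_div_iff₀ hdT).2 hmulT).trans hdiv

theorem eventually_le_of_mul_sub_le {u b R : ℕ → ℝ} {C L n κ z : ℝ}
    (hR : Tendsto R atTop (𝓝 C))
    (hb : Tendsto (fun T : ℕ => (1 / (T : ℝ)) * Real.logb 2 (b T)) atTop (𝓝 0)) (hL : 0 < L)
    (hu : ∀ T : ℕ, u T * (T * L - n * Real.logb 2 (b T) - κ) ≤ T * R T + 1) (hz : C / L < z) :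
    ∀ᶠ T in atTop, u T ≤ z := by
  have hinv : Tendsto (fun T : ℕ => 1 / (T : ℝ)) atTop (𝓝 0) := tendsto_one_div_atTop_nhds_zero_nat
  have hd : Tendsto (fun T : ℕ => L - n * ((1 / (T : ℝ)) * Real.logb 2 (b T)) - κ * (1 / (T : ℝ)))
      atTop (𝓝 L) := by
    simpa using (tendsto_const_nhds.sub (hb.const_mul n)).sub (hinv.const_mul κ)
  have hρ : Tendsto (fun T : ℕ => R T + 1 / (T : ℝ)) atTop (𝓝 C) := by
    simpa using hR.add hinv
  refine eventually_le_of_mul_le hd hρ hL ((eventually_gt_atTop 0).mono fun T hT => ?_) hz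
  have hT' : (0 : ℝ) < T := Nat.cast_pos.2 hT
  refine le_of_mul_le_mul_left (le_of_eq_of_le ?_ ((hu T).trans_eq ?_)) hT'
  · field_simp
  · field_simp

end Asymptotics

section ClosedLoop

theorem LogJacBounds.two_rpow_le {N : ℕ} {f : Vec N → Vec N} {L M : ℝ} (h : LogJacBounds f L M)
    (y : Vec N) : (2 : ℝ) ^ L ≤ |(fderiv ℝ f y).det| :=
  (Real.le_logb_iff_rpow_le one_lt_two (abs_pos.2 (h.det_ne_zero y))).1 (h.isGLB.1 ⟨y, rfl⟩)

theorem LogJacBounds.le {N : ℕ} {f : Vec N → Vec N} {L M : ℝ} (h : LogJacBounds f L M) : L ≤ M :=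
  (h.isGLB.1 ⟨0, rfl⟩).trans (h.isLUB.1 ⟨0, rfl⟩)

namespace IsClosedLoop

variable {Ω A A' : Type*} [MeasurableSpace Ω] [MeasurableSpace A] [MeasurableSpace A']
  {P : Measure Ω} {N m : ℕ} {f : Vec N → Vec N}
  {B : Vec m →ₗ[ℝ] Vec N} {ν : Measure (Vec N)} {W : Channel A A'}
  {γe : (t : ℕ) → (Fin (t + 1) → Vec N) → (Fin t → A') → A}
  {γc : (t : ℕ) → (Fin (t + 1) → A') → Vec m} {x w : ℕ → Ω → Vec N} {u : ℕ → Ω → Vec m}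
  {q : ℕ → Ω → A} {q' : ℕ → Ω → A'}

theorem state_eq_control (h : IsClosedLoop P f B ν W γe γc x w u q q') (t : ℕ) (ω : Ω) :
    x (t + 1) ω = f (x t ω) + B (γc t (hist q' (t + 1) ω)) + w t ω := by
  rw [h.state_eq, h.control_eq]

variable [Finite A'] [MeasurableSingletonClass A']

theorem measurable_state (h : IsClosedLoop P f B ν W γe γc x w u q q') (hf : Measurable f)
    (t : ℕ) : Measurable (x t) := by
  induction t with
  | zero => exact h.measurable_init
  | succ t ih =>
    have hcontrol : Measurable fun ω => B (γc t (hist q' (t + 1) ω)) :=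
      (Measurable.of_discrete (f := fun s => B (γc t s))).comp
        (measurable_hist fun i _ => h.measurable_output i)
    rw [show x (t + 1) = _ from funext (h.state_eq_control t)]
    exact ((hf.comp ih).add hcontrol).add (h.measurable_noise t)

theorem measurable_input (h : IsClosedLoop P f B ν W γe γc x w u q q') (hf : Measurable f)
    (t : ℕ) : Measurable (q t) := by
  rw [show q t = _ from funext (h.encoder_eq t)]
  exact (h.measurable_encoder t).comp ((measurable_hist fun i _ => h.measurable_state hf i).prodMk
    (measurable_hist fun i _ => h.measurable_output i))

theorem isChannelUse (h : IsClosedLoop P f B ν W γe γc x w u q q') (hf : Measurable f)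
    (hmarkov : ∀ t (S : Set A'), P⟦q' t ⁻¹' S | channelPast q q' t ⊔ sourceSigma (x 0) w⟧ =ᵐ[P]
      P⟦q' t ⁻¹' S | channelPast q q' t⟧) :
    IsChannelUse (sourceSigma (x 0) w) P W q q' where
  measurable_input := h.measurable_input hf
  measurable_output := h.measurable_output
  le_ambient := sup_le h.measurable_init.comap_le
    (measurable_pi_lambda _ h.measurable_noise).comap_le
  condLaw t b := (hmarkov t {b}).trans (h.channel_law t b)

end IsClosedLoop

theorem div_le_one_sub_sub_div {C L M : ℝ} (hL : 0 < L) (hLM : L ≤ M) (hCL : C ≤ L) :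
    C / L ≤ 1 - (L - C) / M := by
  have hdiv : (L - C) / M ≤ (L - C) / L := div_le_div_of_nonneg_left (sub_nonneg.2 hCL) hL hLM
  rw [sub_div L C L, div_self hL.ne'] at hdiv
  linarith

end ClosedLoop

end NetCtrl

theorem mainTheorem5_general {Ω A A' E : Type*} [MeasurableSpace Ω]
    [Fintype A] [MeasurableSpace A] [MeasurableSingletonClass A]
    [Fintype A'] [MeasurableSpace A'] [MeasurableSingletonClass A']
    [NormedAddCommGroup E] [NormedSpace ℝ E] [FiniteDimensional ℝ E]
    [MeasurableSpace E] [BorelSpace E] (P : Measure Ω) [IsProbabilityMeasure P]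
    (μ : Measure E) [μ.IsAddHaarMeasure] (f : E → E) (W : NetCtrl.Channel A A')
    (g : (t : ℕ) → (Fin (t + 1) → A') → E) (x w : ℕ → Ω → E) (q : ℕ → Ω → A) (q' : ℕ → Ω → A')
    (C L : ℝ) (hf : ContDiff ℝ 1 f) (hinj : Function.Injective f) (hL : 0 < L)
    (hdet : ∀ y, (2 : ℝ) ^ L ≤ |(fderiv ℝ f y).det|)
    (hx : Measurable (x 0)) (hw : ∀ t, Measurable (w t))
    (hxw : IndepFun (x 0) (fun ω t => w t ω) P)
    (hstate : ∀ t ω, x (t + 1) ω = f (x t ω) + g t (NetCtrl.hist q' (t + 1) ω) + w t ω)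
    (hchannel : NetCtrl.IsChannelUse
      (.comap (x 0) inferInstance ⊔ .comap (fun ω t => w t ω) inferInstance) P W q q')
    (hcapacity : Tendsto (NetCtrl.maxDirectedInfoRate W) atTop (𝓝 C))
    (hx_ac : P.map (x 0) ≪ μ) (b : ℕ → ℝ) (hb_pos : ∀ T, 0 < b T)
    (hb : Tendsto (fun T : ℕ => (1 / (T : ℝ)) * Real.logb 2 (b T)) atTop (𝓝 0)) :
    limsup (fun T : ℕ => P.real {ω | ‖x T ω‖ ≤ b T}) atTop ≤ C / L := by
  refine le_of_forall_pos_le_add fun η hη => ?_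
  obtain ⟨K, hK, G, hG, hGη, hGK⟩ := NetCtrl.exists_measurableSet_restrict_le_smul hx_ac
    (ENNReal.ofReal_pos.2 (half_pos hη))
  have hball : ∀ᶠ T in atTop, P.real {ω | x 0 ω ∈ G ∧ ‖x T ω‖ ≤ b T} ≤ C / L + η / 2 :=
    NetCtrl.eventually_le_of_mul_sub_le hcapacity hb hL
      (fun T => hchannel.measureReal_state_norm_le_mul_le hx hw hxw hstate hf hinj hdet hG hK hGK
        (hb_pos T)) (lt_add_of_pos_right _ (half_pos hη))
  have hcompl : P.real (x 0 ⁻¹' Gᶜ) ≤ η / 2 := by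
    rw [Measure.map_apply hx hG.compl] at hGη
    exact ENNReal.toReal_le_of_le_ofReal (half_pos hη).le hGη
  refine limsup_le_of_le (isCoboundedUnder_le_of_le atTop (x := 0) fun _ => measureReal_nonneg)
    (hball.mono fun T hT => ?_)
  calc P.real {ω | ‖x T ω‖ ≤ b T}
      ≤ P.real ({ω | x 0 ω ∈ G ∧ ‖x T ω‖ ≤ b T} ∪ x 0 ⁻¹' Gᶜ) :=
        measureReal_mono fun ω hω => (Classical.em (x 0 ω ∈ G)).imp (⟨·, hω⟩) id
    _ ≤ (C / L + η / 2) + η / 2 := (measureReal_union_le _ _).trans (add_le_add hT hcompl)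
    _ = C / L + η := by rw [add_assoc, add_halves]

theorem mainTheorem5 {Ω A A' : Type*} [MeasurableSpace Ω]
    [Fintype A] [MeasurableSpace A] [MeasurableSingletonClass A]
    [Fintype A'] [MeasurableSpace A'] [MeasurableSingletonClass A']
    (P : Measure Ω) [IsProbabilityMeasure P] {N m : ℕ}
    (f : NetCtrl.Vec N → NetCtrl.Vec N) (B : NetCtrl.Vec m →ₗ[ℝ] NetCtrl.Vec N)
    (ν : Measure (NetCtrl.Vec N)) (W : NetCtrl.Channel A A')
    (γe : (t : ℕ) → (Fin (t + 1) → NetCtrl.Vec N) → (Fin t → A') → A)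
    (γc : (t : ℕ) → (Fin (t + 1) → A') → NetCtrl.Vec m)
    (x w : ℕ → Ω → NetCtrl.Vec N) (u : ℕ → Ω → NetCtrl.Vec m)
    (q : ℕ → Ω → A) (q' : ℕ → Ω → A') (C L M : ℝ)
    (hf : ContDiff ℝ 1 f) (hf_inv : Function.Bijective f)
    (hbounds : NetCtrl.LogJacBounds f L M)
    (hloop : NetCtrl.IsClosedLoop P f B ν W γe γc x w u q q')
    (hclassA : NetCtrl.IsClassA P W (x 0) w q q' C)
    (hx_ac : P.map (x 0) ≪ volume)
    (hx_entropy : NetCtrl.diffEntropy (P.map (x 0)) < ⊤)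
    (hCL : C < L)
    (b : ℕ → ℝ) (hb_pos : ∀ T, 0 < b T)
    (hb : Tendsto (fun T : ℕ => (1 / (T : ℝ)) * Real.logb 2 (b T)) atTop (𝓝 0)) :
    limsup (fun T : ℕ => P.real {ω | ‖x T ω‖ ≤ b T}) atTop ≤ 1 - (L - C) / M := by
  have hchannel := hloop.isChannelUse hf.continuous.measurable hclassA.markov
  have hL : 0 < L := (hchannel.capacity_nonneg hclassA.capacity).trans_lt hCL
  calc limsup (fun T : ℕ => P.real {ω | ‖x T ω‖ ≤ b T}) atTop ≤ C / L :=
        mainTheorem5_general P volume f W (fun t s => B (γc t s)) x w q q' C L hf hf_inv.injective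
          hL hbounds.two_rpow_le hloop.measurable_init hloop.measurable_noise hloop.init_indep
          hloop.state_eq_control hchannel hclassA.capacity hx_ac b hb_pos hb
    _ ≤ 1 - (L - C) / M := NetCtrl.div_le_one_sub_sub_div hL hbounds.le hCL.le
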